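/- All graphs are finite, simple and undirected; $N(v)$ is the set of neighbours of $v$, $N[v]=N(v)\cup\{v\}$, and $d(v)=|N(v)|$. A graph is well-covered if all its maximal independent sets are maximum. A vertex $v$ of $G$ is shedding if for every independent set $S\subseteq V(G)\setminus N[v]$ there is $u\in N(v)$ such that $S\cup\{u\}$ is independent. A leaf is a vertex of degree $1$, a stem is a vertex adjacent to a leaf, and a $5$-cycle is basic if it does not contain two adjacent vertices of degree at least $3$. **Theorem.** There is an algorithm (a single program for a unit-cost random access machine, with the graph given by adjacency lists in memory) which, given a connected well-covered graph $G$ of girth at least $5$ (possibly infinite) with $n$ vertices and a vertex $v\in V(G)$, decides in $O(n)$ time whether $v$ is shedding. Moreover, for every such $G$ and $v$: 1. if $v$ is a leaf, then $v$ is shedding if and only if $n=2$, i.e. $G=K_2$; 2. if $v$ is a stem, then $v$ is shedding; 3. if $v$ lies on a basic $5$-cycle $C$ and $d(v)=2$, then $v$ is shedding if and only if every neighbour of a vertex of $N(v)$ belongs to $V(C)$; 4. if $v$ lies on a basic $5$-cycle and $d(v)\ge 3$, then $v$ is shedding; 5. if $v$ is neither a leaf nor a stem and lies on no basic $5$-cycle,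 then $v$ is not shedding. -/

import Mathlib

/-! ### Graph notions -/

/-- Every maximal independent set is maximum. -/
def WellCovered {V : Type*} [Finite V] (G : SimpleGraph V) : Prop :=
  ∀ S : Finset V, Maximal (fun T : Finset V => G.IsIndepSet (T : Set V)) S →
    G.IsMaximumIndepSet S

/-- `v` is shedding: every independent set `S ⊆ V \ N[v]` can be extended by some neighbour of `v`
to a larger independent set. -/
def Shedding {V : Type*} (G : SimpleGraph V) (v : V) : Prop :=
  ∀ S : Set V, G.IsIndepSet S → (∀ x ∈ S, x ≠ v ∧ ¬ G.Adj v x) →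
    ∃ u, G.Adj v u ∧ G.IsIndepSet (S ∪ {u})

/-- The degree of a vertex (of a finite graph). -/
noncomputable def deg {V : Type*} (G : SimpleGraph V) (v : V) : ℕ :=
  (G.neighborSet v).ncard

/-- A leaf is a vertex of degree 1. -/
def IsLeaf {V : Type*} (G : SimpleGraph V) (v : V) : Prop :=
  deg G v = 1

/-- A stem is a vertex adjacent to a leaf. -/
def IsStem {V : Type*} (G : SimpleGraph V) (v : V) : Prop :=
  ∃ u, G.Adj v u ∧ IsLeaf G u

/-- `C` is the vertex set of a basic 5-cycle: a 5-cycle without two adjacent vertices of degree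
at least 3. -/
def IsBasicFiveCycle {V : Type*} (G : SimpleGraph V) (C : Set V) : Prop :=
  (∃ (u : V) (p : G.Walk u u), p.IsCycle ∧ p.length = 5 ∧ C = {x | x ∈ p.support}) ∧
    ∀ x ∈ C, ∀ y ∈ C, G.Adj x y → ¬ (3 ≤ deg G x ∧ 3 ≤ deg G y)

/-! ### A unit-cost random access machine

The machine has registers and a memory, both holding natural numbers. The arithmetic consists of
increment and (truncated) decrement only, so after `t` steps every number held by the machine
exceeds the largest number of the input, its length and the constants of the program by at most
`t`: unit cost per step hides no arithmetic on long numbers. -/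

namespace RAM

/-- Instructions. Registers `d`, `s`, `a`, `b`, `i` and labels `l` are fixed numbers written in
the program. -/
inductive Instr
  | const (d c : ℕ)         -- `d := c`
  | copy (d s : ℕ)          -- `d := s`
  | inc (d : ℕ)             -- `d := d + 1`
  | dec (d : ℕ)             -- `d := d - 1`, with `0 - 1 = 0`
  | load (d b i : ℕ)        -- `d := memory[b + i]`
  | store (s b i : ℕ)       -- `memory[b + i] := s`
  | jump (l : ℕ)            -- continue at instruction `l`
  | jumpLt (a b l : ℕ)      -- if `a < b`, continue at instruction `l`
  | halt (answer : Bool)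

/-- A program is a finite list of instructions, numbered from `0`. -/
abbrev Program := List Instr

/-- A configuration: program counter, registers, memory. -/
structure Config where
  pc : ℕ
  reg : ℕ → ℕ
  mem : ℕ → ℕ

/-- The effect of one instruction. -/
def exec (c : Config) : Instr → Config
  | .const d k => { c with pc := c.pc + 1, reg := Function.update c.reg d k }
  | .copy d s => { c with pc := c.pc + 1, reg := Function.update c.reg d (c.reg s) }
  | .inc d => { c with pc := c.pc + 1, reg := Function.update c.reg d (c.reg d + 1) }
  | .dec d => { c with pc := c.pc + 1, reg := Function.update c.reg d (c.reg d - 1) }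
  | .load d b i =>
      { c with pc := c.pc + 1, reg := Function.update c.reg d (c.mem (c.reg b + c.reg i)) }
  | .store s b i =>
      { c with pc := c.pc + 1, mem := Function.update c.mem (c.reg b + c.reg i) (c.reg s) }
  | .jump l => { c with pc := l }
  | .jumpLt a b l => { c with pc := if c.reg a < c.reg b then l else c.pc + 1 }
  | .halt _ => c

/-- One step of the program `P`. A program counter outside the program is stuck (without an
answer). -/
def step (P : Program) (c : Config) : Config :=
  match P[c.pc]? with
  | some instr => exec c instr
  | none => c

/-- The initial configuration: the input occupies the memory cells `0, …, length - 1`, register `0`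
holds the length of the input, and everything else is `0`. -/
def init (input : List ℕ) : Config where
  pc := 0
  reg := Function.update (fun _ => 0) 0 input.length
  mem := fun k => input.getD k 0

/-- On the given input the program halts with answer `b` after at most `T` steps. -/
def AnswersWithin (P : Program) (input : List ℕ) (T : ℕ) (b : Bool) : Prop :=
  ∃ t ≤ T, P[((step P)^[t] (init input)).pc]? = some (.halt b)

end RAM

/-! ### Adjacency lists -/

/-- `adj u` lists the neighbours of `u`, each once, in some order. -/
def IsAdjacencyLists {n : ℕ} (G : SimpleGraph (Fin n)) (adj : Fin n → List (Fin n)) : Prop :=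
  ∀ u, (adj u).Nodup ∧ ∀ w, w ∈ adj u ↔ G.Adj u w

/-- The address at which the adjacency list of `u` starts: after `n`, `v`, the `n` addresses, and
the lists (each preceded by its length) of the vertices before `u`. -/
def listAddress {n : ℕ} (adj : Fin n → List (Fin n)) (u : Fin n) : ℕ :=
  2 + n + ∑ w ∈ Finset.univ.filter (fun w : Fin n => w < u), ((adj w).length + 1)

/-- The standard input of a graph algorithm: the number `n` of vertices, the vertex `v`, for each
vertex the address of its adjacency list, and then the adjacency lists one after the other, each
preceded by its length. -/
def encodeInput {n : ℕ} (adj : Fin n → List (Fin n)) (v : Fin n) : List ℕ :=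
  n :: v.val :: (List.ofFn (listAddress adj) ++
    (List.ofFn fun u => (adj u).length :: (adj u).map Fin.val).flatten)

/-! Well-coveredness enters only through `NoTwinLeaves`: if deleting N[S] leaves two leaves x, y at
b, then in a maximal independent set containing S and b one may exchange b for x and y
(`WellCovered.noTwinLeaves`). Together with girth at least 5 this gives the core, `shedding_iff`: v
is shedding iff it has a neighbour of degree one or lies on a 5-cycle v, u₁, a, b, u₂ in which u₁,
u₂, a have degree two. Sufficiency is easy: an independent set misses a or b, which leaves u₁ or u₂
free.

Necessity is proved by induction on the number of vertices. For s outside N[v], the vertex v is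
still shedding in G - N[s] and all hypotheses pass to that graph, so there v has a pendant neighbour
or a thin cycle. As s shares at most one neighbour with any other vertex, pulling this back to G
gives a `LocalShape` at s, unless G itself has one of the two structures. The shape is taken at a
vertex at distance two from v, and then at further vertices of the shapes found. Every combination
contradicts the girth or, after deletion of the closed neighbourhoods of two or three vertices,
`NoTwinLeaves`.

The five cases are read off from the characterisation, and the algorithm tests it. One pass over the
list of v detects pendant neighbours and marks the ends a of the paths v, u, a with d(u) = 2; a
second pass uses the marks to find a thin cycle. Of a list other than that of v, entries are read
only if its length is two, so the time is even O(d(v) + 1). -/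

/-- No triangles and no 4-cycles. -/
structure GirthFive {V : Type*} (G : SimpleGraph V) : Prop where
  tri : ∀ {a b c}, G.Adj a b → G.Adj b c → ¬ G.Adj a c
  quad : ∀ {x y a b}, x ≠ y → G.Adj x a → G.Adj y a → G.Adj x b → G.Adj y b → a = b

/-- Deleting the closed neighbourhood of an independent set never leaves two leaves attached to
the same vertex. -/
def NoTwinLeaves {V : Type*} (G : SimpleGraph V) : Prop :=
  ∀ (S : Set V) (b x y : V), G.IsIndepSet S → x ≠ y → G.Adj b x → G.Adj b y →
    (∀ s ∈ S, ¬ G.Adj s b ∧ ¬ G.Adj s x ∧ ¬ G.Adj s y) →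
    (∀ z, G.Adj x z → z = b ∨ ∃ s ∈ S, G.Adj s z) →
    (∀ z, G.Adj y z → z = b ∨ ∃ s ∈ S, G.Adj s z) → False

/-- `a` is the only neighbour of `u` other than `v`. -/
structure OnlyOther {V : Type*} (G : SimpleGraph V) (v u a : V) : Prop where
  adj : G.Adj u a
  ne : a ≠ v
  only : ∀ z, G.Adj u z → z = v ∨ z = a

/-- `x` and `y` are two distinct vertices, and the only neighbours of `u` other than `v`. -/
structure TwoOthers {V : Type*} (G : SimpleGraph V) (v u x y : V) : Prop where
  adj_left : G.Adj u x
  adj_right : G.Adj u y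
  ne_left : x ≠ v
  ne_right : y ≠ v
  ne : x ≠ y
  only : ∀ z, G.Adj u z → z = v ∨ z = x ∨ z = y

/-- Some neighbour of `v` has no other neighbour. -/
def HasPendant {V : Type*} (G : SimpleGraph V) (v : V) : Prop :=
  ∃ u, G.Adj v u ∧ ∀ z, G.Adj u z → z = v

/-- `v` lies on a 5-cycle `v, u₁, a, b, u₂` in which `u₁`, `u₂` and `a` have degree two. -/
def HasThinCycle {V : Type*} (G : SimpleGraph V) (v : V) : Prop :=
  ∃ u₁ u₂ a b, u₁ ≠ u₂ ∧ G.Adj v u₁ ∧ G.Adj v u₂ ∧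
    OnlyOther G v u₁ a ∧ OnlyOther G v u₂ b ∧ OnlyOther G u₁ a b

/-- The graph obtained by deleting the closed neighbourhood of `s`. -/
abbrev delNbhd {V : Type*} (G : SimpleGraph V) (s : V) :
    SimpleGraph {x : V // x ≠ s ∧ ¬ G.Adj s x} :=
  G.comap Subtype.val

/-! ### Deletion of a closed neighbourhood and the shapes it comes from -/

section Structure

variable {V : Type*} {G : SimpleGraph V} {v : V}

theorem TwoOthers.symm {u x y : V} (h : TwoOthers G v u x y) : TwoOthers G v u y x :=
  ⟨h.adj_right, h.adj_left, h.ne_right, h.ne_left, h.ne.symm, fun z hz => by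
    rcases h.only z hz with h | h | h <;> simp [h]⟩

theorem isIndepSet_insert_image {s : V} {S : Set {x : V // x ≠ s ∧ ¬ G.Adj s x}}
    (hS : (delNbhd G s).IsIndepSet S) :
    G.IsIndepSet (insert s (Subtype.val '' S)) := by
  rintro x (rfl | ⟨x, hx, rfl⟩) y (rfl | ⟨y, hy, rfl⟩) hne
  · exact absurd rfl hne
  · exact y.2.2
  · exact fun h => x.2.2 h.symm
  · exact hS hx hy (fun h => hne (by rw [h]))

theorem GirthFive.delNbhd (h : GirthFive G) (s : V) : GirthFive (delNbhd G s) where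
  tri h₁ h₂ h₃ := h.tri h₁ h₂ h₃
  quad hne h₁ h₂ h₃ h₄ := Subtype.ext (h.quad (fun e => hne (Subtype.ext e)) h₁ h₂ h₃ h₄)

/-- Adding s to the deleted set turns twin leaves in G - N[s] into twin leaves in G. -/
theorem NoTwinLeaves.delNbhd (h : NoTwinLeaves G) (s : V) : NoTwinLeaves (delNbhd G s) := by
  intro S b x y hS hxy hx hy hno hlx hly
  have key : ∀ w : {x : V // x ≠ s ∧ ¬ G.Adj s x},
      (∀ z, (_root_.delNbhd G s).Adj w z → z = b ∨ ∃ t ∈ S, (_root_.delNbhd G s).Adj t z) →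
      ∀ z, G.Adj w z → z = b ∨ ∃ t ∈ insert s (Subtype.val '' S), G.Adj t z := by
    intro w hw z hz
    by_cases hsz : G.Adj s z
    · exact Or.inr ⟨s, Or.inl rfl, hsz⟩
    · have hzs : z ≠ s := fun e => w.2.2 (e ▸ hz.symm)
      rcases hw ⟨z, hzs, hsz⟩ hz with e | ⟨t, ht, htz⟩
      · exact Or.inl (congrArg Subtype.val e)
      · exact Or.inr ⟨t, Or.inr ⟨t, ht, rfl⟩, htz⟩
  refine h _ b x y (isIndepSet_insert_image hS) (fun e => hxy (Subtype.ext e)) hx hy ?_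
    (key x hlx) (key y hly)
  rintro t (rfl | ⟨t, ht, rfl⟩)
  · exact ⟨b.2.2, x.2.2, y.2.2⟩
  · exact hno t ht

theorem Shedding.delNbhd (h : Shedding G v) {s : V} (hv : v ≠ s ∧ ¬ G.Adj s v) :
    Shedding (delNbhd G s) ⟨v, hv⟩ := by
  intro S hS hSv
  obtain ⟨u, hu, hI⟩ := h _ (isIndepSet_insert_image hS) (by
    rintro x (rfl | ⟨x, hx, rfl⟩)
    · exact ⟨hv.1.symm, fun e => hv.2 e.symm⟩
    · exact ⟨fun e => (hSv x hx).1 (Subtype.ext e), (hSv x hx).2⟩)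
  have hus : u ≠ s := fun e => hv.2 (e ▸ hu.symm)
  have hsu : ¬ G.Adj s u := hI (by simp) (by simp) hus.symm
  refine ⟨⟨u, hus, hsu⟩, hu, ?_⟩
  rintro x (hx | rfl) y (hy | rfl) hne
  · exact hS hx hy hne
  · exact hI (Or.inl (Or.inr ⟨x, hx, rfl⟩)) (Or.inr rfl) (fun e => hne (Subtype.ext e))
  · exact hI (Or.inr rfl) (Or.inl (Or.inr ⟨y, hy, rfl⟩)) (fun e => hne (Subtype.ext e))
  · exact absurd rfl hne

theorem isIndepSet_pair {x y : V} (h : ¬ G.Adj x y) : G.IsIndepSet {x, y} := by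
  rintro a (rfl | rfl) b (rfl | rfl) hne
  · exact absurd rfl hne
  · exact h
  · exact fun e => h e.symm
  · exact absurd rfl hne

theorem isIndepSet_triple {x y z : V} (hxy : ¬ G.Adj x y) (hxz : ¬ G.Adj x z)
    (hyz : ¬ G.Adj y z) : G.IsIndepSet {x, y, z} := by
  rintro a (rfl | rfl | rfl) b (rfl | rfl | rfl) hne <;>
    first
    | exact absurd rfl hne
    | assumption
    | (intro e; have := e.symm; contradiction)

/-- The vertices at distance two from v thus fall into disjoint parts, one for each neighbour of v.
-/
theorem GirthFive.part_unique (h : GirthFive G) {u w x : V} (hu : G.Adj v u) (hw : G.Adj v w)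
    (hux : G.Adj u x) (hwx : G.Adj w x) (hx : x ≠ v) : u = w :=
  h.quad hx.symm hu hux.symm hw hwx.symm

/-- If the unique further neighbours of two neighbours of `v` are adjacent, then `v` lies on a
thin cycle. -/
theorem hasThinCycle_of_onlyOther (h : GirthFive G) (hT : NoTwinLeaves G) {u₁ u₂ a b : V}
    (hne : u₁ ≠ u₂) (h₁ : G.Adj v u₁) (h₂ : G.Adj v u₂) (ha : OnlyOther G v u₁ a)
    (hb : OnlyOther G v u₂ b) (hab : G.Adj a b) : HasThinCycle G v := by
  by_contra hno
  have hab' : a ≠ u₂ := fun e => h.tri h₁ ha.adj (e ▸ h₂)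
  have hba' : b ≠ u₁ := fun e => h.tri h₂ hb.adj (e ▸ h₁)
  -- The cycle is thin as soon as one of a, b has degree two, so both have a third neighbour.
  have hp : ∃ p, G.Adj a p ∧ p ≠ u₁ ∧ p ≠ b := by
    by_contra! hp
    exact hno ⟨u₁, u₂, a, b, hne, h₁, h₂, ha, hb, hab, hba', fun z hz => by
      by_cases e : z = u₁
      · exact Or.inl e
      · exact Or.inr (hp z hz e)⟩
  have hq : ∃ q, G.Adj b q ∧ q ≠ u₂ ∧ q ≠ a := by
    by_contra! hq
    exact hno ⟨u₂, u₁, b, a, hne.symm, h₂, h₁, hb, ha, hab.symm, hab', fun z hz => by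
      by_cases e : z = u₂
      · exact Or.inl e
      · exact Or.inr (hq z hz e)⟩
  obtain ⟨p, hap, hp₁, hp₂⟩ := hp
  obtain ⟨q, hbq, hq₁, hq₂⟩ := hq
  have hpq : ¬ G.Adj p q := fun e => hq₂ (h.quad hp₂.symm hbq e hab.symm hap.symm)
  have hva : ¬ G.Adj v a := h.tri h₁ ha.adj
  have hvb : ¬ G.Adj v b := h.tri h₂ hb.adj
  -- Deleting N[p] and N[q] removes a and b, which makes u₁ and u₂ twin leaves at v.
  refine hT {p, q} v u₁ u₂ (isIndepSet_pair hpq) hne h₁ h₂ ?_ ?_ ?_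
  · rintro s (rfl | rfl)
    · refine ⟨fun e => hp₁ (h.part_unique e.symm h₁ hap.symm ha.adj ha.ne),
        fun e => h.tri ha.adj hap e.symm, fun e => ?_⟩
      rcases hb.only _ e.symm with rfl | rfl
      · exact hva hap.symm
      · exact hp₂ rfl
    · refine ⟨fun e => hq₁ (h.part_unique e.symm h₂ hbq.symm hb.adj hb.ne), fun e => ?_,
        fun e => h.tri hb.adj hbq e.symm⟩
      rcases ha.only _ e.symm with rfl | rfl
      · exact hvb hbq.symm
      · exact hq₂ rfl
  · intro z hz
    exact (ha.only z hz).imp_right fun e => ⟨p, by simp, by rw [e]; exact hap.symm⟩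
  · intro z hz
    exact (hb.only z hz).imp_right fun e => ⟨q, by simp, by rw [e]; exact hbq.symm⟩

/-- What remains possible at a vertex `s` outside the closed neighbourhood of `v` once the
conclusion is known in `G - N[s]`. -/
inductive LocalShape (G : SimpleGraph V) (v s : V) : Prop
  | one (u b : V) (hu : G.Adj v u) (hb : OnlyOther G v u b) (hsb : G.Adj s b)
  | mixed (u w x x' b : V) (hne : u ≠ w) (hu : G.Adj v u) (hw : G.Adj v w)
      (hx : TwoOthers G v u x x') (hb : OnlyOther G v w b) (hsx : G.Adj s x) (hxb : G.Adj x' b)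
      (hdeg : (∀ z, G.Adj x' z → z = u ∨ z = b ∨ G.Adj s z) ∨
        (∀ z, G.Adj b z → z = w ∨ z = x' ∨ G.Adj s z))
  | two (u w x x' y y' : V) (hne : u ≠ w) (hu : G.Adj v u) (hw : G.Adj v w)
      (hx : TwoOthers G v u x x') (hy : TwoOthers G v w y y') (hsx : G.Adj s x) (hsy : G.Adj s y)
      (hxy : G.Adj x' y') (hdeg : ∀ z, G.Adj x' z → z = u ∨ z = y' ∨ G.Adj s z)

/-- Passing to G - N[s] costs u at most one neighbour, since two common neighbours of u and s would
give a 4-cycle. -/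
theorem onlyOther_or_twoOthers (h : GirthFive G) {s u a : V} (hs : v ≠ s ∧ ¬ G.Adj s v)
    (hus : u ≠ s) (hua : G.Adj u a) (hav : a ≠ v) (hsa : ¬ G.Adj s a)
    (hall : ∀ z, G.Adj u z → z = v ∨ z = a ∨ G.Adj s z) :
    OnlyOther G v u a ∨ ∃ x, TwoOthers G v u x a ∧ G.Adj s x := by
  by_cases hx : ∃ x, G.Adj u x ∧ G.Adj s x
  · obtain ⟨x, hux, hsx⟩ := hx
    refine Or.inr ⟨x, ⟨hux, hua, fun e => hs.2 (e ▸ hsx), hav, fun e => hsa (e ▸ hsx), ?_⟩, hsx⟩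
    intro z hz
    rcases hall z hz with e | e | e
    · exact Or.inl e
    · exact Or.inr (Or.inr e)
    · exact Or.inr (Or.inl (h.quad hus hz e hux hsx))
  · push Not at hx
    exact Or.inl ⟨hua, hav, fun z hz => (hall z hz).imp id fun e =>
      e.resolve_right (hx z hz)⟩

/-- A pendant neighbour in G - N[s] gives `one`. For a thin cycle in G - N[s], the shape depends on
how many of u₁, u₂ have lost a neighbour to N[s]; if none has, G already has a thin cycle. The
alternative in `mixed` arises because the degree-two vertex a may lie on either side. -/
theorem localShape_of_delNbhd (h : GirthFive G) (hT : NoTwinLeaves G) (hnp : ¬ HasPendant G v)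
    (hnc : ¬ HasThinCycle G v) {s : V} (hs : v ≠ s ∧ ¬ G.Adj s v)
    (H : HasPendant (delNbhd G s) ⟨v, hs⟩ ∨ HasThinCycle (delNbhd G s) ⟨v, hs⟩) :
    LocalShape G v s := by
  have lift : ∀ {p : V → Prop} {u : V}, ¬ G.Adj s u →
      (∀ z : {x : V // x ≠ s ∧ ¬ G.Adj s x}, G.Adj u z → p z) →
      ∀ z, G.Adj u z → p z ∨ G.Adj s z := by
    intro p u hu hp z hz
    by_cases e : G.Adj s z
    · exact Or.inr e
    · exact Or.inl (hp ⟨z, fun e => hu (e ▸ hz.symm), e⟩ hz)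
  rcases H with ⟨u, hu, hall⟩ | ⟨u₁, u₂, a, b, hne, h₁, h₂, ha, hb, hab⟩
  · have hall' := lift (p := fun z => z = v) u.2.2 fun z hz => congrArg Subtype.val (hall z hz)
    have : ∃ z, G.Adj u z ∧ z ≠ v := by
      by_contra! hh
      exact hnp ⟨u, hu, hh⟩
    obtain ⟨z, huz, hzv⟩ := this
    have hsz := (hall' z huz).resolve_left hzv
    exact .one u z hu ⟨huz, hzv, fun z' hz' => (hall' z' hz').imp id fun e =>
      h.quad u.2.1 hz' e huz hsz⟩ hsz
  · have hne' : (u₁ : V) ≠ u₂ := fun e => hne (Subtype.ext e)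
    have hane : (a : V) ≠ v := fun e => ha.ne (Subtype.ext e)
    have hbne : (b : V) ≠ v := fun e => hb.ne (Subtype.ext e)
    have aall := lift (p := fun z => z = v ∨ z = a) u₁.2.2 fun z hz =>
      (ha.only z hz).imp (congrArg Subtype.val) (congrArg Subtype.val)
    have ball := lift (p := fun z => z = v ∨ z = b) u₂.2.2 fun z hz =>
      (hb.only z hz).imp (congrArg Subtype.val) (congrArg Subtype.val)
    have dall := lift (p := fun z => z = u₁ ∨ z = b) a.2.2 fun z hz =>
      (hab.only z hz).imp (congrArg Subtype.val) (congrArg Subtype.val)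
    simp only [or_assoc] at aall ball dall
    have hadj : G.Adj a b := hab.adj
    rcases onlyOther_or_twoOthers h hs u₁.2.1 ha.adj hane a.2.2 aall with A | ⟨x, A, hx⟩
    · rcases onlyOther_or_twoOthers h hs u₂.2.1 hb.adj hbne b.2.2 ball with B | ⟨y, B, hy⟩
      · exact absurd (hasThinCycle_of_onlyOther h hT hne' h₁ h₂ A B hab.adj) hnc
      · exact .mixed u₂ u₁ y b a hne'.symm h₂ h₁ B A hy hadj.symm (Or.inr dall)
    · rcases onlyOther_or_twoOthers h hs u₂.2.1 hb.adj hbne b.2.2 ball with B | ⟨y, B, hy⟩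
      · exact .mixed u₁ u₂ x a b hne' h₁ h₂ A B hx hadj (Or.inl dall)
      · exact .two u₁ u₂ x a y b hne' h₁ h₂ A B hx hy hadj dall

end Structure

/-! ### Excluding combinations of shapes -/

section Structure

variable {V : Type*} {G : SimpleGraph V} {v : V}

/-- In `TwoOthers G v u x x'` the vertex x' is called the mate of x; it depends on x alone, because
x lies in only one part. -/
theorem TwoOthers.mate_unique (h : GirthFive G) {u w x x' x'' : V} (hu : G.Adj v u)
    (hw : G.Adj v w) (hx : TwoOthers G v u x x') (hx' : TwoOthers G v w x x'') : x' = x'' := by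
  obtain rfl := h.part_unique hu hw hx.adj_left hx'.adj_left hx.ne_left
  rcases hx.only _ hx'.adj_right with e | e | e
  · exact absurd e hx'.ne_right
  · exact absurd e.symm hx'.ne
  · exact e.symm

theorem TwoOthers.not_adj_mate (h : GirthFive G) {s u x x' : V} (hs : ¬ G.Adj s v)
    (hu : G.Adj v u) (hx : TwoOthers G v u x x') (hsx : G.Adj s x) : ¬ G.Adj s x' := by
  intro e
  refine hx.ne (h.quad ?_ hx.adj_left hsx hx.adj_right e)
  rintro rfl
  exact hs hu.symm

theorem GirthFive.ne_of_adj (h : GirthFive G) {u w x : V} (hu : G.Adj v u) (hw : G.Adj v w)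
    (hux : G.Adj u x) : x ≠ w := by
  rintro rfl
  exact h.tri hu hux hw

theorem GirthFive.not_adj_center (h : GirthFive G) {u x : V} (hu : G.Adj v u)
    (hux : G.Adj u x) : ¬ G.Adj x v := fun e => h.tri hu hux e.symm

theorem not_onlyOther_of_twoOthers {u x x' b : V} (hx : TwoOthers G v u x x')
    (hb : OnlyOther G v u b) : False := by
  have h₁ := (hb.only x hx.adj_left).resolve_left hx.ne_left
  have h₂ := (hb.only x' hx.adj_right).resolve_left hx.ne_right
  exact hx.ne (h₁.trans h₂.symm)

/-- If the unique further neighbours `b`, `c` of two neighbours of `v` are distinct, then all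
neighbours of `b` and `c` on the far side are adjacent. -/
theorem adj_of_onlyOther (h : GirthFive G) (hT : NoTwinLeaves G) {u w b c y z : V}
    (hne : u ≠ w) (hu : G.Adj v u) (hw : G.Adj v w) (hb : OnlyOther G v u b)
    (hc : OnlyOther G v w c) (hby : G.Adj b y) (hcz : G.Adj c z) (hyu : y ≠ u) (hzw : z ≠ w)
    (hbc : ¬ G.Adj b c) : G.Adj y z := by
  by_contra hyz
  have key : ∀ {u w b c y}, G.Adj v u → G.Adj v w → OnlyOther G v u b → OnlyOther G v w c →
      G.Adj b y → y ≠ u → ¬ G.Adj b c → ¬ G.Adj y v ∧ ¬ G.Adj y u ∧ ¬ G.Adj y w := by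
    intro u w b c y hu hw hb hc hby hyu hbc
    refine ⟨fun e => hyu (h.part_unique e.symm hu hby.symm hb.adj hb.ne),
      fun e => h.tri hb.adj hby e.symm, fun e => ?_⟩
    rcases hc.only _ e.symm with rfl | rfl
    · exact h.tri hu hb.adj hby.symm
    · exact hbc hby
  -- Deleting N[y] and N[z] removes b and c, so u and w become twin leaves at v.
  refine hT {y, z} v u w (isIndepSet_pair hyz) hne hu hw ?_ ?_ ?_
  · rintro s (rfl | rfl)
    · exact key hu hw hb hc hby hyu hbc
    · obtain ⟨h₁, h₂, h₃⟩ := key hw hu hc hb hcz hzw (fun e => hbc e.symm)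
      exact ⟨h₁, h₃, h₂⟩
  · intro t ht
    exact (hb.only t ht).imp_right fun e => ⟨y, by simp, by rw [e]; exact hby.symm⟩
  · intro t ht
    exact (hc.only t ht).imp_right fun e => ⟨z, by simp, by rw [e]; exact hcz.symm⟩

/-- If b ≠ c, the shape at b can only be `two`, so b has two neighbours x, y besides u; likewise c
has a neighbour z besides w. By `adj_of_onlyOther` z is adjacent to x and y, and b, x, z, y is a
4-cycle. -/
theorem onlyOther_unique (h : GirthFive G) (hT : NoTwinLeaves G) (hnc : ¬ HasThinCycle G v)
    (H : ∀ s, v ≠ s ∧ ¬ G.Adj s v → LocalShape G v s) {u w b c : V}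
    (hu : G.Adj v u) (hw : G.Adj v w) (hb : OnlyOther G v u b) (hc : OnlyOther G v w c) :
    b = c := by
  by_contra hne
  have huw : ∀ {u w b c}, OnlyOther G v u b → OnlyOther G v w c → b ≠ c → u ≠ w := by
    rintro u w b c hb hc hne rfl
    exact hne ((hc.only _ hb.adj).resolve_left hb.ne)
  have nadj : ∀ {u w b c}, G.Adj v u → G.Adj v w → OnlyOther G v u b → OnlyOther G v w c →
      ¬ G.Adj b c := fun hu hw hb hc e =>
    hnc (hasThinCycle_of_onlyOther h hT (huw hb hc e.ne) hu hw hb hc e)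
  have outside : ∀ {u b}, G.Adj v u → OnlyOther G v u b → v ≠ b ∧ ¬ G.Adj b v :=
    fun hu hb => ⟨hb.ne.symm, fun e => h.tri hu hb.adj e.symm⟩
  have two : ∀ {u b}, G.Adj v u → OnlyOther G v u b → ∃ x y, x ≠ y ∧ G.Adj b x ∧ G.Adj b y ∧
      x ≠ u ∧ y ≠ u := by
    intro u b hu hb
    cases H b (outside hu hb) with
    | one w c hw hc hbc => exact absurd hbc (nadj hu hw hb hc)
    | mixed w t x x' c hne hw ht hx hc hbx hxc hdeg =>
      exfalso
      have hbc : b ≠ c := by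
        rintro rfl
        exact hx.not_adj_mate h (h.not_adj_center hu hb.adj) hw hbx hxc.symm
      have := adj_of_onlyOther h hT (huw hb hc hbc) hu ht hb hc hbx hxc.symm (h.ne_of_adj hw hu hx.adj_left)
        (h.ne_of_adj hw ht hx.adj_right) (nadj hu ht hb hc)
      exact h.tri hx.adj_left this hx.adj_right
    | two w t x x' y y' hne hw ht hx hy hbx hby hxy hdeg =>
      refine ⟨x, y, ?_, hbx, hby, h.ne_of_adj hw hu hx.adj_left,
        h.ne_of_adj ht hu hy.adj_left⟩
      rintro rfl
      exact hne (h.part_unique hw ht hx.adj_left hy.adj_left hx.ne_left)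
  obtain ⟨x, y, hxy, hbx, hby, hxu, hyu⟩ := two hu hb
  obtain ⟨z, -, -, hcz, -, hzw, -⟩ := two hw hc
  have h₁ := adj_of_onlyOther h hT (huw hb hc hne) hu hw hb hc hbx hcz hxu hzw (nadj hu hw hb hc)
  have h₂ := adj_of_onlyOther h hT (huw hb hc hne) hu hw hb hc hby hcz hyu hzw (nadj hu hw hb hc)
  have hbz : b ≠ z := by
    rintro rfl
    exact nadj hw hu hc hb hcz
  exact hxy (h.quad hbz hbx h₁.symm hby h₂.symm)

/-- Two successive shapes of the second kind leave a vertex of degree two. -/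
theorem exists_degree_two (h : GirthFive G) (hT : NoTwinLeaves G) {s ux uy x x' y y' wq q q' : V}
    (hs : ¬ G.Adj s v) (hux : G.Adj v ux) (huy : G.Adj v uy) (hwq : G.Adj v wq)
    (hx : TwoOthers G v ux x x') (hy : TwoOthers G v uy y y') (hq : TwoOthers G v wq q q')
    (hne : wq ≠ uy) (hsx : G.Adj s x) (hsy : G.Adj s y) (hsq : G.Adj s q) (hxy : G.Adj x' y')
    (hxq : G.Adj x' q) (hyq : G.Adj y q')
    (hdeg : ∀ z, G.Adj x' z → z = ux ∨ z = y' ∨ G.Adj s z) : ∀ z, G.Adj q' z → z = wq ∨ z = y := by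
  intro z hz
  by_contra! hzne
  obtain ⟨hzw, hzy⟩ := hzne
  have hsx' : ¬ G.Adj s x' := hx.not_adj_mate h hs hux hsx
  have hsq' : ¬ G.Adj q' v := h.not_adj_center hwq hq.adj_right
  have hsne : q' ≠ s := by
    rintro rfl
    exact h.tri hq.adj_left hsq.symm hq.adj_right
  have hzs : ¬ G.Adj s z := fun e => hzy (h.quad hsne hz e hyq.symm hsy)
  have hzx : ¬ G.Adj x' z := by
    intro e
    rcases hdeg z e with rfl | rfl | e
    · obtain rfl := h.part_unique hux hwq hz.symm hq.adj_right hq.ne_right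
      exact h.tri hx.adj_right hxq hq.adj_left
    · exact hy.not_adj_mate h hsq' huy hyq.symm hz
    · exact hzs e
  have hzuy : ¬ G.Adj z uy := by
    intro e
    refine hzy (h.quad ?_ e.symm hz hy.adj_left hyq.symm)
    rintro rfl
    exact hsq' huy.symm
  -- Here s removes y and q, x' removes y', and z removes q', so uy and wq become twin leaves at v.
  refine hT {s, x', z} v uy wq (isIndepSet_triple hsx' hzs hzx) hne.symm huy hwq ?_ ?_ ?_
  · rintro t (rfl | rfl | rfl)
    · exact ⟨hs, fun e => h.tri e hy.adj_left hsy, fun e => h.tri e hq.adj_left hsq⟩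
    · exact ⟨fun e => h.tri hux hx.adj_right e.symm, fun e => h.tri e hy.adj_right hxy,
        fun e => h.tri e hq.adj_left hxq⟩
    · exact ⟨fun e => hzw (h.part_unique e.symm hwq hz.symm hq.adj_right hq.ne_right), hzuy,
        fun e => h.tri hq.adj_right hz e.symm⟩
  · intro t ht
    rcases hy.only t ht with rfl | rfl | rfl
    · exact Or.inl rfl
    · exact Or.inr ⟨s, by simp, hsy⟩
    · exact Or.inr ⟨x', by simp, hxy⟩
  · intro t ht
    rcases hq.only t ht with rfl | rfl | rfl
    · exact Or.inl rfl
    · exact Or.inr ⟨s, by simp, hsq⟩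
    · exact Or.inr ⟨z, by simp, hz.symm⟩

/-- If `s` is the only vertex that can be the single further neighbour of a neighbour of `v`, then
no configuration of the second kind at `s` is followed by another one. -/
theorem not_two_two (h : GirthFive G) (hT : NoTwinLeaves G)
    (H : ∀ s, v ≠ s ∧ ¬ G.Adj s v → LocalShape G v s) {s ux uy x x' y y' wq q q' : V}
    (hone : ∀ u b, G.Adj v u → OnlyOther G v u b → b = s)
    (hs : ¬ G.Adj s v) (hux : G.Adj v ux) (huy : G.Adj v uy) (hwq : G.Adj v wq)
    (hx : TwoOthers G v ux x x') (hy : TwoOthers G v uy y y') (hq : TwoOthers G v wq q q')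
    (hne : wq ≠ uy) (hsx : G.Adj s x) (hsy : G.Adj s y) (hsq : G.Adj s q) (hxy : G.Adj x' y')
    (hxq : G.Adj x' q) (hyq : G.Adj y q')
    (hdeg : ∀ z, G.Adj x' z → z = ux ∨ z = y' ∨ G.Adj s z) : False := by
  have hall := exists_degree_two h hT hs hux huy hwq hx hy hq hne hsx hsy hsq hxy hxq hyq hdeg
  have key : ∀ {u t}, G.Adj v u → G.Adj u t → G.Adj q' t → t = y := fun hu ht hqt =>
    (hall _ hqt).resolve_left (h.ne_of_adj hu hwq ht)
  -- The only neighbour of q' at distance two from v can be y, which is incompatible with each shape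
  -- at q'.
  cases H q' ⟨hq.ne_right.symm, h.not_adj_center hwq hq.adj_right⟩ with
  | one u b hu hb hqb =>
    obtain rfl := key hu hb.adj hqb
    exact hsy.ne (hone u _ hu hb).symm
  | mixed u w t t' b hne hu hw ht hb hqt htb hdeg =>
    obtain rfl := key hu ht.adj_left hqt
    obtain rfl := hone w b hw hb
    obtain rfl := hy.mate_unique h huy hu ht
    exact hy.not_adj_mate h hs huy hsy htb.symm
  | two u w t t' r r' hne hu hw ht hr hqt hqr htr hdeg =>
    obtain rfl := key hu ht.adj_left hqt
    obtain rfl := key hw hr.adj_left hqr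
    exact hne (h.part_unique hu hw ht.adj_left hr.adj_left ht.ne_left)

/-- As `not_two_two`, for the shapes themselves. -/
theorem not_two_two_shapes (h : GirthFive G) (hT : NoTwinLeaves G)
    (H : ∀ s, v ≠ s ∧ ¬ G.Adj s v → LocalShape G v s) {s ux uy x x' y y' wp wq p p' q q' : V}
    (hone : ∀ u b, G.Adj v u → OnlyOther G v u b → b = s)
    (hs : ¬ G.Adj s v) (hux : G.Adj v ux) (huy : G.Adj v uy) (hwp : G.Adj v wp) (hwq : G.Adj v wq)
    (hx : TwoOthers G v ux x x') (hy : TwoOthers G v uy y y')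
    (hp : TwoOthers G v wp p p') (hq : TwoOthers G v wq q q')
    (hne : wp ≠ wq) (hsx : G.Adj s x) (hsy : G.Adj s y) (hxy : G.Adj x' y')
    (hxp : G.Adj x' p) (hxq : G.Adj x' q) (hpq : G.Adj p' q')
    (hdeg : ∀ z, G.Adj x' z → z = ux ∨ z = y' ∨ G.Adj s z) : False := by
  have hpq_ne : p ≠ q := by
    rintro rfl
    exact hne (h.part_unique hwp hwq hp.adj_left hq.adj_left hp.ne_left)
  -- Both p and q lie in {y'} ∪ N(s), and not both in N(s), since x' and s share at most one
  -- neighbour. So p = y' up to symmetry; then p' = y, and q is adjacent to s.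
  have final : ∀ {wp wq p p' q q'}, G.Adj v wp → G.Adj v wq → TwoOthers G v wp p p' →
      TwoOthers G v wq q q' → wp ≠ wq → p ≠ q → G.Adj x' q → G.Adj p' q' → p = y' → False := by
    rintro wp wq p p' q q' hwp hwq hp hq hne hpq_ne hxq hpq rfl
    obtain rfl := h.part_unique hwp huy hp.adj_left hy.adj_right hp.ne_left
    obtain rfl := hp.mate_unique h hwp hwp hy.symm
    have hsq := ((hdeg q hxq).resolve_left (h.ne_of_adj hwq hux hq.adj_left)).resolve_left
      hpq_ne.symm
    exact not_two_two h hT H hone hs hux huy hwq hx hy hq hne.symm hsx hsy hsq hxy hxq hpq hdeg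
  rcases (hdeg p hxp).resolve_left (h.ne_of_adj hwp hux hp.adj_left) with e | hsp
  · exact final hwp hwq hp hq hne hpq_ne hxq hpq e
  rcases (hdeg q hxq).resolve_left (h.ne_of_adj hwq hux hq.adj_left) with e | hsq
  · exact final hwq hwp hq hp hne.symm hpq_ne.symm hxp hpq.symm e
  refine hpq_ne (h.quad ?_ hsp hxp hsq hxq)
  rintro rfl
  exact h.tri hx.adj_left hsx.symm hx.adj_right

/-- A configuration of the second kind at the single further neighbour `b` of a neighbour of `v`
is not followed by a mixed one. -/
theorem not_two_mixed (h : GirthFive G) (hT : NoTwinLeaves G) {u b ux uy x x' y y' wp p p' : V}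
    (hu : G.Adj v u) (hb : OnlyOther G v u b)
    (hux : G.Adj v ux) (huy : G.Adj v uy) (hwp : G.Adj v wp) (hne : ux ≠ uy)
    (hx : TwoOthers G v ux x x') (hy : TwoOthers G v uy y y') (hp : TwoOthers G v wp p p')
    (hbx : G.Adj b x) (hby : G.Adj b y) (hxy : G.Adj x' y') (hxp : G.Adj x' p)
    (hpb : G.Adj p' b) (hdeg : ∀ z, G.Adj x' z → z = ux ∨ z = y' ∨ G.Adj b z)
    (hdeg' : (∀ z, G.Adj p' z → z = wp ∨ z = b ∨ G.Adj x' z) ∨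
      (∀ z, G.Adj b z → z = u ∨ z = p' ∨ G.Adj x' z)) : False := by
  have hbv : ¬ G.Adj b v := h.not_adj_center hu hb.adj
  have hx'v : ¬ G.Adj x' v := h.not_adj_center hux hx.adj_right
  have hy'v : ¬ G.Adj y' v := h.not_adj_center huy hy.adj_right
  have hyv : ¬ G.Adj y v := h.not_adj_center huy hy.adj_left
  have hxv : ¬ G.Adj x v := h.not_adj_center hux hx.adj_left
  have hx'x : ¬ G.Adj x' x := fun e => h.tri hx.adj_right e hx.adj_left
  have hy'y : ¬ G.Adj y' y := fun e => h.tri hy.adj_right e hy.adj_left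
  have hx'y : ¬ G.Adj x' y := hy.symm.not_adj_mate h hx'v huy hxy
  have hy'x : ¬ G.Adj y' x := hx.symm.not_adj_mate h hy'v hux hxy.symm
  have hby' : ¬ G.Adj b y' := hy.not_adj_mate h hbv huy hby
  -- The second alternative would force x = p' = y, as neither x nor y is adjacent to x'.
  have hdeg' := hdeg'.resolve_right fun hall => by
    have h₁ := ((hall x hbx).resolve_left (h.ne_of_adj hux hu hx.adj_left)).resolve_right hx'x
    have h₂ := ((hall y hby).resolve_left (h.ne_of_adj huy hu hy.adj_left)).resolve_right hx'y
    obtain rfl := h₁.trans h₂.symm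
    exact hne (h.part_unique hux huy hx.adj_left hy.adj_left hx.ne_left)
  have hpy : p = y' := ((hdeg p hxp).resolve_left (h.ne_of_adj hwp hux hp.adj_left)).resolve_right
    (hp.symm.not_adj_mate h hbv hwp hpb.symm)
  -- From here on p stands for y', p' for y, and wp for uy.
  obtain rfl := hpy
  obtain rfl := h.part_unique hwp huy hp.adj_left hy.adj_right hp.ne_left
  obtain rfl := hp.mate_unique h hwp hwp hy.symm
  have hNy : ∀ z, G.Adj p' z → z = wp ∨ z = b := by
    intro z hz
    rcases hdeg' z hz with e | e | e
    · exact Or.inl e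
    · exact Or.inr e
    · rcases hdeg z e with rfl | rfl | e
      · exact absurd (h.part_unique hux hwp hz.symm hp.adj_right hp.ne_right) hne
      · exact absurd hz.symm hy'y
      · exact absurd e (h.tri hpb.symm hz)
  -- For any other neighbour z of x, deleting the closed neighbourhoods of p', p, z takes b from u,
  -- and x', x from ux; then u and ux are twin leaves at v.
  have hNx : ∀ z, G.Adj x z → z = b ∨ z = ux ∨ G.Adj p z := by
    intro z hz
    by_contra! hzne
    obtain ⟨hzb, hzu, hpz⟩ := hzne
    have hp'z : ¬ G.Adj p' z := by
      intro e
      rcases hNy z e with rfl | e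
      · exact hne (h.part_unique hux hwp hx.adj_left hz.symm hx.ne_left)
      · exact hzb e
    have hnu : ∀ t, t ≠ v → t ≠ b → ¬ G.Adj t u := fun t htv htb e =>
      (hb.only t e.symm).elim htv htb
    refine hT {p', p, z} v u ux (isIndepSet_triple (fun e => hy'y e.symm) hp'z hpz) ?_ hu hux
      ?_ ?_ ?_
    · rintro rfl
      exact not_onlyOther_of_twoOthers hx hb
    · rintro t (rfl | rfl | rfl)
      · exact ⟨hyv, hnu _ hp.ne_right hpb.ne, fun e => hne (h.part_unique hux hwp e.symm hp.adj_right hp.ne_right)⟩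
      · exact ⟨hy'v, hnu _ hp.ne_left (by rintro rfl; exact hy'y hpb.symm), fun e => hne (h.part_unique hux hwp e.symm hp.adj_left hp.ne_left)⟩
      · exact ⟨fun e => hzu (h.part_unique e.symm hux hz.symm hx.adj_left hx.ne_left),
          hnu _ (by rintro rfl; exact hxv hz) hzb,
          fun e => h.tri hx.adj_left hz e.symm⟩
    · intro t ht
      exact (hb.only t ht).imp_right fun e => ⟨p', by simp, by rw [e]; exact hpb⟩
    · intro t ht
      rcases hx.only t ht with rfl | rfl | rfl
      · exact Or.inl rfl
      · exact Or.inr ⟨z, by simp, hz.symm⟩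
      · exact Or.inr ⟨p, by simp, hxy.symm⟩
  -- By `hNx` and `hNy`, deleting N[v] and N[p] leaves x and p' with b as their only neighbour.
  refine hT {v, p} b x p' (isIndepSet_pair fun e => hy'v e.symm) ?_ hbx hby ?_ ?_ ?_
  · rintro rfl
    exact hne (h.part_unique hux hwp hx.adj_left hp.adj_right hx.ne_left)
  · rintro t (rfl | rfl)
    · exact ⟨fun e => hbv e.symm, fun e => hxv e.symm, fun e => hyv e.symm⟩
    · exact ⟨fun e => hby' e.symm, hy'x, hy'y⟩
  · intro t ht
    rcases hNx t ht with e | rfl | e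
    · exact Or.inl e
    · exact Or.inr ⟨v, by simp, hux⟩
    · exact Or.inr ⟨p, by simp, e⟩
  · intro t ht
    rcases hNy t ht with rfl | e
    · exact Or.inr ⟨v, by simp, hwp⟩
    · exact Or.inl e

end Structure

/-! ### The characterisation of shedding vertices -/

section Structure

variable {V : Type*} {G : SimpleGraph V} {v : V}

/-- If some neighbour of v has a single further neighbour b, then b is unique and the shape at b
must be `two`. If there is no such b, every shape is `two`. In both cases the shape at the vertex x'
found there leads to a contradiction. -/
theorem hasPendant_or_hasThinCycle_of_delNbhd (h : GirthFive G) (hT : NoTwinLeaves G)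
    (hsh : Shedding G v)
    (H : ∀ s (hs : v ≠ s ∧ ¬ G.Adj s v),
      HasPendant (delNbhd G s) ⟨v, hs⟩ ∨ HasThinCycle (delNbhd G s) ⟨v, hs⟩) :
    HasPendant G v ∨ HasThinCycle G v := by
  by_contra! hno
  obtain ⟨hnp, hnc⟩ := hno
  have L : ∀ s, v ≠ s ∧ ¬ G.Adj s v → LocalShape G v s := fun s hs =>
    localShape_of_delNbhd h hT hnp hnc hs (H s hs)
  have outside : ∀ {u x}, G.Adj v u → G.Adj u x → x ≠ v → v ≠ x ∧ ¬ G.Adj x v :=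
    fun hu hux hx => ⟨hx.symm, h.not_adj_center hu hux⟩
  by_cases hone : ∃ u b, G.Adj v u ∧ OnlyOther G v u b
  · obtain ⟨u, b, hu, hb⟩ := hone
    have uniq : ∀ w c, G.Adj v w → OnlyOther G v w c → c = b := fun w c hw hc =>
      onlyOther_unique h hT hnc L hw hu hc hb
    have hbv := outside hu hb.adj hb.ne
    cases L b hbv with
    | one w c hw hc hbc => exact hbc.ne (uniq w c hw hc).symm
    | mixed w t x x' c hne hw ht hx hc hbx hxc hdeg =>
      obtain rfl := uniq t c ht hc
      exact hx.not_adj_mate h hbv.2 hw hbx hxc.symm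
    | two ux uy x x' y y' hne hux huy hx hy hbx hby hxy hdeg =>
      have hbx' := hx.not_adj_mate h hbv.2 hux hbx
      cases L x' (outside hux hx.adj_right hx.ne_right) with
      | one w c hw hc hxc =>
        obtain rfl := uniq w c hw hc
        exact hbx' hxc.symm
      | mixed w t p p' c hne' hw ht hp hc hxp hpc hdeg' =>
        obtain rfl := uniq t c ht hc
        exact not_two_mixed h hT ht hc hux huy hw hne hx hy hp hbx hby hxy hxp hpc hdeg hdeg'
      | two wp wq p p' q q' hne' hwp hwq hp hq hxp hxq hpq hdeg' =>
        exact not_two_two_shapes h hT L uniq hbv.2 hux huy hwp hwq hx hy hp hq hne' hbx hby hxy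
          hxp hxq hpq hdeg
  · push Not at hone
    -- The empty set serves to show that v has a neighbour.
    obtain ⟨u, hu, -⟩ := hsh ∅ (by simp [SimpleGraph.IsIndepSet]) (by simp)
    have : ∃ s, G.Adj u s ∧ s ≠ v := by
      by_contra! hh
      exact hnp ⟨u, hu, hh⟩
    obtain ⟨s, hus, hsv⟩ := this
    have hs := outside hu hus hsv
    cases L s hs with
    | one w c hw hc hbc => exact hone w c hw hc
    | mixed w t x x' c hne hw ht hx hc hbx hxc hdeg => exact hone t c ht hc
    | two ux uy x x' y y' hne hux huy hx hy hbx hby hxy hdeg =>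
      cases L x' (outside hux hx.adj_right hx.ne_right) with
      | one w c hw hc hxc => exact hone w c hw hc
      | mixed w t p p' c hne' hw ht hp hc hxp hpc hdeg' => exact hone t c ht hc
      | two wp wq p p' q q' hne' hwp hwq hp hq hxp hxq hpq hdeg' =>
        exact not_two_two_shapes h hT L (fun w c hw hc => (hone w c hw hc).elim) hs.2 hux huy
          hwp hwq hx hy hp hq hne' hbx hby hxy hxp hxq hpq hdeg

theorem Shedding.hasPendant_or_hasThinCycle [Finite V] (h : GirthFive G) (hT : NoTwinLeaves G)
    (hsh : Shedding G v) : HasPendant G v ∨ HasThinCycle G v := by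
  induction hn : Nat.card V using Nat.strong_induction_on generalizing V with
  | _ n ih =>
    refine hasPendant_or_hasThinCycle_of_delNbhd h hT hsh fun s hs => ?_
    refine ih _ ?_ (h.delNbhd s) (hT.delNbhd s) (hsh.delNbhd hs) rfl
    rw [← hn]
    exact Set.ncard_lt_card (s := {x | x ≠ s ∧ ¬ G.Adj s x})
      (fun e => absurd (e ▸ Set.mem_univ s : s ∈ {x | x ≠ s ∧ ¬ G.Adj s x}) (by simp))

theorem HasPendant.shedding (h : HasPendant G v) : Shedding G v := by
  obtain ⟨u, hu, hall⟩ := h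
  refine fun S hS hSv => ⟨u, hu, ?_⟩
  rintro x (hx | rfl) y (hy | rfl) hne
  · exact hS hx hy hne
  · exact fun e => (hSv x hx).1 (hall x e.symm)
  · exact fun e => (hSv y hy).1 (hall y e)
  · exact absurd rfl hne

theorem shedding_of_onlyOther {u₁ u₂ a b : V} (h₁ : G.Adj v u₁) (h₂ : G.Adj v u₂)
    (ha : OnlyOther G v u₁ a) (hb : OnlyOther G v u₂ b) (hab : G.Adj a b) : Shedding G v := by
  intro S hS hSv
  have key : ∀ {u c}, G.Adj v u → OnlyOther G v u c → c ∉ S →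
      ∃ u, G.Adj v u ∧ G.IsIndepSet (S ∪ {u}) := by
    intro u c hu hc hcS
    have hno : ∀ x ∈ S, ¬ G.Adj u x := fun x hx e => by
      rcases hc.only x e with rfl | rfl
      · exact (hSv _ hx).1 rfl
      · exact hcS hx
    refine ⟨u, hu, ?_⟩
    rintro x (hx | rfl) y (hy | rfl) hne
    · exact hS hx hy hne
    · exact fun e => hno x hx e.symm
    · exact hno y hy
    · exact absurd rfl hne
  by_cases haS : a ∈ S
  · exact key h₂ hb fun hbS => hS haS hbS hab.ne hab
  · exact key h₁ ha haS

theorem shedding_iff [Finite V] (h : GirthFive G) (hT : NoTwinLeaves G) :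
    Shedding G v ↔ HasPendant G v ∨ HasThinCycle G v := by
  refine ⟨fun hsh => hsh.hasPendant_or_hasThinCycle h hT, ?_⟩
  rintro (hp | ⟨u₁, u₂, a, b, -, h₁, h₂, ha, hb, hab⟩)
  · exact hp.shedding
  · exact shedding_of_onlyOther h₁ h₂ ha hb hab.adj

/-- A maximal independent set I ⊇ S ∪ {b} avoids every neighbour of x and y other than b, so I - b +
x + y is independent and larger. -/
theorem WellCovered.noTwinLeaves [Finite V] (h : WellCovered G) (hG : GirthFive G) :
    NoTwinLeaves G := by
  classical
  intro S b x y hS hxy hx hy hno hlx hly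
  have := Fintype.ofFinite V
  have hSb : G.IsIndepSet ((insert b S.toFinset : Finset V) : Set V) := by
    rintro s hs t ht hne
    simp only [Finset.coe_insert, Set.coe_toFinset, Set.mem_insert_iff] at hs ht
    rcases hs with rfl | hs <;> rcases ht with rfl | ht
    · exact absurd rfl hne
    · exact fun e => (hno t ht).1 e.symm
    · exact (hno s hs).1
    · exact hS hs ht hne
  obtain ⟨I, hbI, hI⟩ := Set.Finite.exists_le_maximal
    (s := {T : Finset V | G.IsIndepSet (T : Set V)}) (Set.toFinite _) hSb
  have hIm := h I hI
  have hbI' : b ∈ I := hbI (by simp)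
  have hSI : ∀ s ∈ S, s ∈ I := fun s hs => hbI (by simp [hs])
  have far : ∀ {w}, (∀ z, G.Adj w z → z = b ∨ ∃ s ∈ S, G.Adj s z) →
      ∀ z ∈ I, z ≠ b → ¬ G.Adj w z := by
    intro w hw z hz hzb e
    rcases hw z e with e | ⟨s, hs, hsz⟩
    · exact hzb e
    · exact hI.1 (hSI s hs) hz hsz.ne hsz
  have hxI : x ∉ I := fun e => hI.1 hbI' e hx.ne hx
  have hyI : y ∉ I := fun e => hI.1 hbI' e hy.ne hy
  have hind : G.IsIndepSet ((insert x (insert y (I.erase b)) : Finset V) : Set V) := by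
    have hxy' : ¬ G.Adj x y := fun e => hG.tri hx e hy
    rintro s hs t ht hne
    simp only [Finset.coe_insert, Finset.coe_erase, Set.mem_insert_iff, Set.mem_sdiff,
      Finset.mem_coe, Set.mem_singleton_iff] at hs ht
    rcases hs with rfl | rfl | hs <;> rcases ht with rfl | rfl | ht
    · exact absurd rfl hne
    · exact hxy'
    · exact far hlx t ht.1 ht.2
    · exact fun e => hxy' e.symm
    · exact absurd rfl hne
    · exact far hly t ht.1 ht.2
    · exact fun e => far hlx s hs.1 hs.2 e.symm
    · exact fun e => far hly s hs.1 hs.2 e.symm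
    · exact hI.1 hs.1 ht.1 hne
  have hcard := hIm.2 _ hind
  rw [Finset.card_insert_of_notMem (by simp [hxy, hxI]), Finset.card_insert_of_notMem
    (by simp [hyI]), Finset.card_erase_of_mem hbI'] at hcard
  have := Finset.card_pos.mpr ⟨b, hbI'⟩
  omega

theorem girthFive_of_egirth (h : 5 ≤ G.egirth) : GirthFive G where
  tri {a b c} hab hbc hac := by
    have := (SimpleGraph.le_egirth.mp h) a
      (SimpleGraph.Walk.cons hab (.cons hbc (.cons hac.symm .nil))) (by
        simp [SimpleGraph.Walk.isCycle_def, SimpleGraph.Walk.isTrail_def, hab.ne, hbc.ne, hac.ne,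
          hab.ne.symm, hac.ne.symm])
    norm_cast at this
  quad {x y a b} hxy hxa hya hxb hyb := by
    by_contra hab
    have := (SimpleGraph.le_egirth.mp h) x
      (SimpleGraph.Walk.cons hxa (.cons hya.symm (.cons hyb (.cons hxb.symm .nil)))) (by
        simp [SimpleGraph.Walk.isCycle_def, SimpleGraph.Walk.isTrail_def, hxa.ne, hxb.ne,
          hyb.ne, hxa.ne.symm, hxb.ne.symm, hya.ne.symm, hxy, Ne.symm hxy, hab])
    norm_cast at this

end Structure

/-! ### Leaves, stems and basic 5-cycles -/

section CaseAnalysis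

variable {V : Type*} {G : SimpleGraph V} {v : V}

theorem isStem_iff_hasPendant : IsStem G v ↔ HasPendant G v := by
  refine exists_congr fun u => and_congr_right fun hu => ?_
  unfold IsLeaf deg
  rw [Set.ncard_eq_one]
  constructor
  · rintro ⟨w, hw⟩ z hz
    have hz : z ∈ G.neighborSet u := hz
    have hv : v ∈ G.neighborSet u := hu.symm
    rw [hw] at hz hv
    exact hz.trans hv.symm
  · exact fun h => ⟨v, Set.ext fun z => ⟨h z, fun e => e ▸ hu.symm⟩⟩

theorem exists_of_isCycle {C : Set V}
    (hC : ∃ (u : V) (p : G.Walk u u), p.IsCycle ∧ p.length = 5 ∧ C = {x | x ∈ p.support})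
    (hv : v ∈ C) : ∃ u₁ a b u₂, C = {v, u₁, a, b, u₂} ∧ G.Adj v u₁ ∧ G.Adj u₁ a ∧ G.Adj a b ∧
      G.Adj b u₂ ∧ G.Adj v u₂ ∧ u₁ ≠ u₂ ∧ a ≠ v ∧ b ≠ v := by
  classical
  obtain ⟨u, p, hp, hlen, rfl⟩ := hC
  have hq := hp.rotate hv
  have hmem : ∀ x, x ∈ p.support ↔ x ∈ (p.rotate v hv).support := fun x =>
    (SimpleGraph.Walk.mem_support_rotate_iff ..).symm
  have hlen' : (p.rotate v hv).length = 5 := by rw [SimpleGraph.Walk.length_rotate, hlen]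
  simp only [hmem]
  generalize p.rotate v hv = q at hq hlen'
  match q, hlen' with
  | .cons (v := u₁) h₁ (.cons (v := a) h₂ (.cons (v := b) h₃ (.cons (v := u₂) h₄
      (.cons h₅ .nil)))), _ =>
    have := hq.support_nodup
    simp only [SimpleGraph.Walk.support_cons, SimpleGraph.Walk.support_nil, List.tail_cons,
      List.nodup_cons, List.mem_cons, not_or] at this
    refine ⟨u₁, a, b, u₂, ?_, h₁, h₂, h₃, h₄, h₅.symm, by tauto, by tauto, by tauto⟩
    ext x
    simp
    tauto

variable [Finite V]

theorem OnlyOther.deg_le_two {u a : V} (h : OnlyOther G v u a) : deg G u ≤ 2 :=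
  (Set.ncard_le_ncard (t := {v, a}) fun z hz => h.only z hz).trans
    (Set.ncard_insert_le ..|>.trans (by rw [Set.ncard_singleton]))

theorem eq_or_eq_of_deg_le_two {u x y z : V} (h : deg G u ≤ 2) (hxy : x ≠ y) (hx : G.Adj u x)
    (hy : G.Adj u y) (hz : G.Adj u z) : z = x ∨ z = y := by
  have hsub : ({x, y} : Set V) ⊆ G.neighborSet u := by
    rintro _ (rfl | rfl) <;> assumption
  have := Set.eq_of_subset_of_ncard_le hsub (by rw [Set.ncard_pair hxy]; exact h)
  have hz : z ∈ G.neighborSet u := hz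
  rw [← this] at hz
  exact hz

/-- A leaf lies on no cycle, so a shedding leaf has a pendant neighbour, and the edge between them
is a whole component. -/
theorem shedding_leaf_iff {n : ℕ} {G : SimpleGraph (Fin n)} {v : Fin n} (h : GirthFive G)
    (hT : NoTwinLeaves G) (hconn : G.Connected) (hv : IsLeaf G v) : Shedding G v ↔ n = 2 := by
  obtain ⟨u, hu⟩ := Set.ncard_eq_one.mp hv
  have hvu : ∀ z, G.Adj v z ↔ z = u := fun z => Set.ext_iff.mp hu z
  have hadj : G.Adj v u := (hvu u).mpr rfl
  constructor
  · rw [shedding_iff h hT]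
    rintro (⟨w, hw, hall⟩ | ⟨u₁, u₂, a, b, hne, h₁, h₂, -⟩)
    · obtain rfl := (hvu w).mp hw
      have key : ∀ z, z = v ∨ z = w := by
        intro z
        have := (SimpleGraph.reachable_iff_reflTransGen v z).mp (hconn.preconnected v z)
        induction this with
        | refl => exact Or.inl rfl
        | tail _ hbc ih =>
          rcases ih with rfl | rfl
          · exact Or.inr ((hvu _).mp hbc)
          · exact Or.inl (hall _ hbc)
      have : (Finset.univ : Finset (Fin n)) = {v, w} := by
        ext z
        simpa using key z
      have := congrArg Finset.card this
      rwa [Finset.card_univ, Fintype.card_fin, Finset.card_pair hadj.ne] at this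
    · exact absurd (((hvu _).mp h₁).trans ((hvu _).mp h₂).symm) hne
  · rintro rfl
    refine HasPendant.shedding ⟨u, hadj, fun z hz => ?_⟩
    have h₁ := hadj.ne
    have h₂ := hz.ne
    omega

/-- Both neighbours of v have a second neighbour on C, so neither is pendant. As d(v) = 2, a thin
cycle through v uses both of them, so their neighbours are exactly those on C. Conversely, C has no
chords because there are no triangles. -/
theorem shedding_iff_of_deg_eq_two (h : GirthFive G) (hT : NoTwinLeaves G) {C : Set V}
    (hC : IsBasicFiveCycle G C) (hv : v ∈ C) (hdeg : deg G v = 2) :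
    Shedding G v ↔ ∀ u, G.Adj v u → G.neighborSet u ⊆ C := by
  obtain ⟨u₁, a, b, u₂, rfl, h₁, ha, hab, hb, h₂, hne, hav, hbv⟩ := exists_of_isCycle hC.1 hv
  have hN : ∀ u, G.Adj v u → u = u₁ ∨ u = u₂ := fun u hu =>
    eq_or_eq_of_deg_le_two hdeg.le hne h₁ h₂ hu
  constructor
  · rw [shedding_iff h hT]
    rintro (⟨w, hw, hall⟩ | ⟨w₁, w₂, c, d, hw, hw₁, hw₂, hc, hd, -⟩)
    · rcases hN w hw with rfl | rfl
      · exact absurd (hall _ ha) hav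
      · exact absurd (hall _ hb.symm) hbv
    · have key : ∀ u, G.Adj v u → ∃ c, OnlyOther G v u c := by
        intro u hu
        rcases hN u hu with rfl | rfl <;> rcases hN w₁ hw₁ with rfl | rfl <;>
          rcases hN w₂ hw₂ with rfl | rfl <;> first | exact ⟨_, hc⟩ | exact ⟨_, hd⟩ | contradiction
      intro u hu z hz
      obtain ⟨e, he⟩ := key u hu
      have hz := he.only z hz
      rcases hN u hu with rfl | rfl
      · have := (he.only a ha).resolve_left hav
        simp only [Set.mem_insert_iff]
        grind
      · have := (he.only b hb.symm).resolve_left hbv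
        simp only [Set.mem_insert_iff]
        grind
  · intro hsub
    refine shedding_of_onlyOther h₁ h₂ ⟨ha, hav, fun z hz => ?_⟩ ⟨hb.symm, hbv, fun z hz => ?_⟩ hab
    · rcases hsub _ h₁ hz with e | rfl | e | rfl | rfl
      · exact Or.inl e
      · exact absurd hz (G.loopless.irrefl _)
      · exact Or.inr e
      · exact absurd hz (h.tri ha hab)
      · exact absurd h₂ (h.tri h₁ hz)
    · rcases hsub _ h₂ hz with e | rfl | rfl | e | rfl
      · exact Or.inl e
      · exact absurd h₁ (h.tri h₂ hz)
      · exact absurd hz (h.tri hb.symm hab.symm)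
      · exact Or.inr e
      · exact absurd hz (G.loopless.irrefl _)

theorem shedding_of_three_le_deg {C : Set V} (hC : IsBasicFiveCycle G C) (hv : v ∈ C)
    (hdeg : 3 ≤ deg G v) : Shedding G v := by
  obtain ⟨u₁, a, b, u₂, rfl, h₁, ha, hab, hb, h₂, hne, hav, hbv⟩ := exists_of_isCycle hC.1 hv
  have d₁ : deg G u₁ ≤ 2 := by
    have := hC.2 v (by simp) u₁ (by simp) h₁
    omega
  have d₂ : deg G u₂ ≤ 2 := by
    have := hC.2 v (by simp) u₂ (by simp) h₂
    omega
  exact shedding_of_onlyOther h₁ h₂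
    ⟨ha, hav, fun z hz => eq_or_eq_of_deg_le_two d₁ hav.symm h₁.symm ha hz⟩
    ⟨hb.symm, hbv, fun z hz => eq_or_eq_of_deg_le_two d₂ hbv.symm h₂.symm hb.symm hz⟩ hab

/-- Only v and b can have degree at least 3, and they are not adjacent, since v, u₂, b would form a
triangle. -/
theorem HasThinCycle.exists_isBasicFiveCycle (h : GirthFive G) (hv : HasThinCycle G v) :
    ∃ C, IsBasicFiveCycle G C ∧ v ∈ C := by
  obtain ⟨u₁, u₂, a, b, hne, h₁, h₂, ha, hb, hab⟩ := hv
  let p : G.Walk v v := .cons h₁ (.cons ha.adj (.cons hab.adj (.cons hb.adj.symm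
    (.cons h₂.symm .nil))))
  have hau : a ≠ u₂ := (h.ne_of_adj h₁ h₂ ha.adj)
  have hbv : ¬ G.Adj v b := h.tri h₂ hb.adj
  refine ⟨{x | x ∈ p.support}, ⟨⟨v, p, ?_, rfl, rfl⟩, ?_⟩, by simp [p]⟩
  · simp [p, SimpleGraph.Walk.isCycle_def, SimpleGraph.Walk.isTrail_def, h₁.ne, h₂.ne, ha.ne,
      hb.ne, hne, hau, h₁.ne.symm, h₂.ne.symm, ha.ne.symm, hb.ne.symm, hab.ne.symm, ha.adj.ne,
      hab.adj.ne, hb.adj.ne.symm]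
  · have d₁ := ha.deg_le_two
    have d₂ := hb.deg_le_two
    have d₃ := hab.deg_le_two
    have key : ∀ x, x ∈ p.support → 3 ≤ deg G x → x = v ∨ x = b := by
      intro x hx hd
      simp only [p, SimpleGraph.Walk.support_cons, SimpleGraph.Walk.support_nil,
        List.mem_cons, List.not_mem_nil, or_false] at hx
      rcases hx with rfl | rfl | rfl | rfl | rfl | rfl
      all_goals first | exact Or.inl rfl | exact Or.inr rfl | omega
    rintro x hx y hy hxy ⟨hdx, hdy⟩
    rcases key x hx hdx with rfl | rfl <;> rcases key y hy hdy with rfl | rfl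
    · exact hxy.ne rfl
    · exact hbv hxy
    · exact hbv hxy.symm
    · exact hxy.ne rfl

end CaseAnalysis

/-! ### Symbolic execution of programs -/

namespace RAM

/-- Started at the configuration `c`, the program halts with answer `ans` after at most `T`
steps. -/
def Ends (P : Program) (c : Config) (T : ℕ) (ans : Bool) : Prop :=
  ∃ t ≤ T, P[((step P)^[t] c).pc]? = some (.halt ans)

variable {P : Program} {k T : ℕ} {r m : ℕ → ℕ} {ans : Bool}

theorem Ends.mono {c : Config} {T' : ℕ} (h : Ends P c T ans) (hT : T ≤ T') : Ends P c T' ans :=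
  let ⟨t, ht, he⟩ := h
  ⟨t, ht.trans hT, he⟩

theorem Ends.next {i : Instr} (hi : P[k]? = some i) (h : Ends P (exec ⟨k, r, m⟩ i) T ans) :
    Ends P ⟨k, r, m⟩ (T + 1) ans := by
  obtain ⟨t, ht, he⟩ := h
  refine ⟨t + 1, by omega, ?_⟩
  rw [Function.iterate_succ_apply]
  have : step P ⟨k, r, m⟩ = exec ⟨k, r, m⟩ i := by
    simp only [step, hi]
  rwa [this]

theorem Ends.halt (hi : P[k]? = some (.halt ans)) : Ends P ⟨k, r, m⟩ T ans :=
  ⟨0, Nat.zero_le _, hi⟩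

theorem Ends.const {d x : ℕ} (hi : P[k]? = some (.const d x))
    (h : Ends P ⟨k + 1, Function.update r d x, m⟩ T ans) : Ends P ⟨k, r, m⟩ (T + 1) ans :=
  .next hi h

/-- The new value is a variable tied by an equation, here and below, so that each use can choose a
simple form for it. -/
theorem Ends.copy {d s x : ℕ} (hi : P[k]? = some (.copy d s)) (hx : r s = x)
    (h : Ends P ⟨k + 1, Function.update r d x, m⟩ T ans) : Ends P ⟨k, r, m⟩ (T + 1) ans :=
  .next hi (by subst hx; exact h)

theorem Ends.inc {d x : ℕ} (hi : P[k]? = some (.inc d)) (hx : r d + 1 = x)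
    (h : Ends P ⟨k + 1, Function.update r d x, m⟩ T ans) : Ends P ⟨k, r, m⟩ (T + 1) ans :=
  .next hi (by subst hx; exact h)

theorem Ends.dec {d x : ℕ} (hi : P[k]? = some (.dec d)) (hx : r d - 1 = x)
    (h : Ends P ⟨k + 1, Function.update r d x, m⟩ T ans) : Ends P ⟨k, r, m⟩ (T + 1) ans :=
  .next hi (by subst hx; exact h)

theorem Ends.load {d b i x : ℕ} (hi : P[k]? = some (.load d b i)) (hx : m (r b + r i) = x)
    (h : Ends P ⟨k + 1, Function.update r d x, m⟩ T ans) : Ends P ⟨k, r, m⟩ (T + 1) ans :=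
  .next hi (by subst hx; exact h)

theorem Ends.store {s b i a x : ℕ} (hi : P[k]? = some (.store s b i)) (ha : r b + r i = a)
    (hx : r s = x) (h : Ends P ⟨k + 1, r, Function.update m a x⟩ T ans) :
    Ends P ⟨k, r, m⟩ (T + 1) ans :=
  .next hi (by subst hx ha; exact h)

theorem Ends.jump {l : ℕ} (hi : P[k]? = some (.jump l)) (h : Ends P ⟨l, r, m⟩ T ans) :
    Ends P ⟨k, r, m⟩ (T + 1) ans :=
  .next hi h

theorem Ends.jumpLt_of_lt {a b l : ℕ} (hi : P[k]? = some (.jumpLt a b l)) (hlt : r a < r b)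
    (h : Ends P ⟨l, r, m⟩ T ans) : Ends P ⟨k, r, m⟩ (T + 1) ans :=
  .next hi (by simpa only [exec, if_pos hlt] using h)

theorem Ends.jumpLt_of_le {a b l : ℕ} (hi : P[k]? = some (.jumpLt a b l)) (hle : r b ≤ r a)
    (h : Ends P ⟨k + 1, r, m⟩ T ans) : Ends P ⟨k, r, m⟩ (T + 1) ans :=
  .next hi (by simpa only [exec, if_neg hle.not_gt] using h)

/-- Four instructions which load into register `d` the entry other than `r w` of a list of length
two that starts at the address `r b + 1`. -/
theorem Ends.select {d b w i j a : ℕ} (hi₀ : P[k]? = some (.load d b i))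
    (hi₁ : P[k + 1]? = some (.jumpLt d w (k + 4))) (hi₂ : P[k + 2]? = some (.jumpLt w d (k + 4)))
    (hi₃ : P[k + 3]? = some (.load d b j)) (hb : b ≠ d) (hw : w ≠ d) (hj : j ≠ d)
    (hx : m (r b + r i) = a ∧ a ≠ r w ∨ m (r b + r i) = r w ∧ m (r b + r j) = a)
    (h : Ends P ⟨k + 4, Function.update r d a, m⟩ T ans) : Ends P ⟨k, r, m⟩ (T + 4) ans := by
  rcases hx with ⟨hx, hne⟩ | ⟨hx, hy⟩
  · refine .load hi₀ hx ?_
    -- There is no equality test, so inequality is detected by a strict comparison in one of the two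
    -- directions.
    rcases lt_or_gt_of_ne hne with hlt | hlt
    · exact (Ends.jumpLt_of_lt hi₁ (by simpa [hw] using hlt) h).mono (by omega)
    · exact (Ends.jumpLt_of_le hi₁ (by simpa [hw] using hlt.le)
        (.jumpLt_of_lt hi₂ (by simpa [hw] using hlt) h)).mono (by omega)
  · refine .load hi₀ hx ?_
    refine .jumpLt_of_le hi₁ (by simp [hw]) (.jumpLt_of_le hi₂ (by simp [hw]) ?_)
    refine .load hi₃ (x := a) (by simpa [hb, hj] using hy) ?_
    rwa [Function.update_idem]

end RAM

/-! ### Reading the input from memory -/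

section Encoding

theorem getElem?_flatten_ofFn {α : Type*} {n : ℕ} (f : Fin n → List α) (u : Fin n) (j : ℕ)
    (hj : j < (f u).length) :
    (List.ofFn f).flatten[(∑ w ∈ Finset.univ.filter (fun w : Fin n => w < u), (f w).length) + j]? =
      some (f u)[j] := by
  induction n with
  | zero => exact u.elim0
  | succ n ih =>
    rw [List.ofFn_succ, List.flatten_cons]
    rw [Finset.sum_filter, Fin.sum_univ_succ]
    cases u using Fin.cases with
    | zero => simp [List.getElem?_append_left hj]
    | succ u =>
      have := ih (fun i => f i.succ) u hj
      rw [Finset.sum_filter] at this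
      simp only [Fin.succ_pos, if_true, Fin.succ_lt_succ_iff]
      rw [List.getElem?_append_right (by omega), ← this]
      congr 1
      omega

variable {n : ℕ} {adj : Fin n → List (Fin n)} {v : Fin n}

theorem encodeInput_getElem?_listAddress (u : Fin n) (j : ℕ) (hj : j < (adj u).length + 1) :
    (encodeInput adj v)[listAddress adj u + j]? =
      some (((adj u).length :: (adj u).map Fin.val)[j]'(by simpa using hj)) := by
  have := getElem?_flatten_ofFn (fun u => (adj u).length :: (adj u).map Fin.val) u j
    (by simpa using hj)
  rw [← this]
  simp only [List.length_cons, List.length_map, encodeInput, listAddress]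
  rw [show ∀ s : ℕ, 2 + n + s + j = n + (s + j) + 1 + 1 by intros; omega,
    List.getElem?_cons_succ, List.getElem?_cons_succ, List.getElem?_append_right (by simp)]
  simp

/-- The memory `m` holds the input on the first `L` cells. -/
def HoldsInput (adj : Fin n → List (Fin n)) (v : Fin n) (m : ℕ → ℕ) : Prop :=
  ∀ k < (encodeInput adj v).length, m k = (encodeInput adj v).getD k 0

/-- The marks are stored behind the input and leave it intact. -/
theorem HoldsInput.update {m : ℕ → ℕ} (h : HoldsInput adj v m) (k x : ℕ) :
    HoldsInput adj v (Function.update m ((encodeInput adj v).length + k) x) := by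
  intro i hi
  rw [Function.update_of_ne (by omega)]
  exact h i hi

theorem HoldsInput.eq_of_getElem? {m : ℕ → ℕ} (h : HoldsInput adj v m) {k x : ℕ}
    (hk : (encodeInput adj v)[k]? = some x) : m k = x := by
  rw [h k (List.getElem?_eq_some_iff.mp hk).1, List.getD_eq_getElem?_getD, hk, Option.getD_some]

theorem HoldsInput.vertex {m : ℕ → ℕ} (h : HoldsInput adj v m) : m 1 = v :=
  h.eq_of_getElem? rfl

theorem HoldsInput.address {m : ℕ → ℕ} (h : HoldsInput adj v m) (u : Fin n) :
    m (2 + u) = listAddress adj u := by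
  refine h.eq_of_getElem? ?_
  rw [encodeInput, add_comm, List.getElem?_cons_succ, List.getElem?_cons_succ,
    List.getElem?_append_left (by simp)]
  simp

theorem HoldsInput.length {m : ℕ → ℕ} (h : HoldsInput adj v m) (u : Fin n) :
    m (listAddress adj u) = (adj u).length :=
  h.eq_of_getElem? (encodeInput_getElem?_listAddress u 0 (by simp))

theorem HoldsInput.entry {m : ℕ → ℕ} (h : HoldsInput adj v m) (u : Fin n) (j : ℕ)
    (hj : j < (adj u).length) : m (listAddress adj u + (j + 1)) = (adj u)[j] := by
  refine (h.eq_of_getElem? (encodeInput_getElem?_listAddress u (j + 1) (by omega))).trans ?_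
  simp

end Encoding

/-! ### The program, its correctness and its running time -/

section Program

open RAM

/-- The program. Registers: `0` length of the input, `1` the vertex `v`, `2` and `3` the constants
`1` and `2`, `4` the address of the list of `v`, `5` the current address in it, `6` the number of
entries left, `7` the current neighbour `u`, `8` and `9` address and length of a list, `10` zero,
`11` and `12` selected entries, `13` a mark. The first loop answers `true` if some `u` has degree
one, and marks the other neighbour of every `u` of degree two. The second loop answers `true` if
the other neighbour `a` of some `u` of degree two has degree two and its other neighbour is
marked. -/
def sheddingProgram : Program :=
  [.const 2 1, .const 3 2, .load 1 2 10, .load 4 3 1, .load 6 4 10, .copy 5 4,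
   .jumpLt 10 6 8, .jump 22, .dec 6, .inc 5, .load 7 5 10, .load 8 3 7, .load 9 8 10,
   .jumpLt 3 9 6, .jumpLt 2 9 16, .halt true,
   .load 11 8 2, .jumpLt 11 1 20, .jumpLt 1 11 20, .load 11 8 3, .store 2 0 11, .jump 6,
   .load 6 4 10, .copy 5 4,
   .jumpLt 10 6 26, .halt false, .dec 6, .inc 5, .load 7 5 10, .load 8 3 7, .load 9 8 10,
   .jumpLt 3 9 24,
   .load 11 8 2, .jumpLt 11 1 36, .jumpLt 1 11 36, .load 11 8 3,
   .load 8 3 11, .load 9 8 10, .jumpLt 3 9 24, .jumpLt 2 9 41, .jump 24,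
   .load 12 8 2, .jumpLt 12 7 45, .jumpLt 7 12 45, .load 12 8 3,
   .load 13 0 12, .jumpLt 10 13 48, .jump 24, .halt true]

variable {n : ℕ} {G : SimpleGraph (Fin n)} {adj : Fin n → List (Fin n)} {v : Fin n}

/-- `a` is the entry other than `v` of the list of `u`, which has length two. -/
def OtherEntry (adj : Fin n → List (Fin n)) (v u a : Fin n) : Prop :=
  (adj u).length = 2 ∧ a ∈ adj u ∧ a ≠ v

theorem otherEntry_iff (h : IsAdjacencyLists G adj) {u a : Fin n} (hu : G.Adj u v) :
    OtherEntry adj v u a ↔ OnlyOther G v u a := by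
  have hv := ((h u).2 v).mpr hu
  constructor
  · rintro ⟨hl, ha, hne⟩
    refine ⟨((h u).2 a).mp ha, hne, fun z hz => ?_⟩
    have hz := ((h u).2 z).mpr hz
    obtain ⟨x, y, hxy⟩ := List.length_eq_two.mp hl
    rw [hxy] at ha hv hz
    simp only [List.mem_cons, List.not_mem_nil, or_false] at ha hv hz
    grind
  · rintro ⟨ha, hne, hall⟩
    refine ⟨?_, ((h u).2 a).mpr ha, hne⟩
    have : (adj u).toFinset = {v, a} := by
      ext z
      simp only [List.mem_toFinset, (h u).2, Finset.mem_insert, Finset.mem_singleton]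
      refine ⟨hall z, ?_⟩
      rintro (rfl | rfl) <;> assumption
    rw [← List.toFinset_card_of_nodup (h u).1, this, Finset.card_pair hne.symm]

theorem exists_otherEntry (h : IsAdjacencyLists G adj) {u : Fin n} (hu : G.Adj u v)
    (hl : (adj u).length = 2) {m : ℕ → ℕ} {w : Fin n} (hm : HoldsInput adj w m) :
    ∃ a, OtherEntry adj v u a ∧
      (m (listAddress adj u + 1) = a ∧ (a : ℕ) ≠ v ∨
        m (listAddress adj u + 1) = v ∧ m (listAddress adj u + 2) = a) := by
  have hv := ((h u).2 v).mpr hu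
  have hnd := (h u).1
  have h₀ := hm.entry u 0 (by omega)
  have h₁ := hm.entry u 1 (by omega)
  unfold OtherEntry
  obtain ⟨x, y, hxy⟩ := List.length_eq_two.mp hl
  simp only [hxy, zero_add, List.getElem_cons_zero, List.getElem_cons_succ] at h₀ h₁
  simp only [hxy, List.mem_cons, List.not_mem_nil, or_false] at hv
  simp only [hxy, List.nodup_cons, List.mem_singleton] at hnd
  rw [hxy]
  rcases hv with rfl | rfl
  · exact ⟨y, ⟨rfl, by simp, fun e => hnd.1 e.symm⟩, Or.inr ⟨h₀, h₁⟩⟩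
  · exact ⟨x, ⟨rfl, by simp, hnd.1⟩, Or.inl ⟨h₀, fun e => hnd.1 (Fin.ext e)⟩⟩

theorem OtherEntry.unique (h : IsAdjacencyLists G adj) {u a b : Fin n} (hu : G.Adj u v)
    (ha : OtherEntry adj v u a) (hb : OtherEntry adj v u b) : a = b :=
  ((((otherEntry_iff h hu).mp hb).only a ((otherEntry_iff h hu).mp ha).adj).resolve_left ha.2.2)

/-- The registers that are never changed within the loops. -/
structure HoldsConstants (adj : Fin n → List (Fin n)) (v : Fin n) (r : ℕ → ℕ) : Prop where
  r0 : r 0 = (encodeInput adj v).length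
  r1 : r 1 = v
  r2 : r 2 = 1
  r3 : r 3 = 2
  r4 : r 4 = listAddress adj v
  r10 : r 10 = 0

/-- The vertices that are the other entry of one of the lists `adj u` for `u ∈ l`, and no others,
are marked. -/
def HoldsMarks (adj : Fin n → List (Fin n)) (v : Fin n) (l : List (Fin n)) (m : ℕ → ℕ) : Prop :=
  ∀ x : Fin n, 0 < m ((encodeInput adj v).length + x) ↔ ∃ u ∈ l, OtherEntry adj v u x

/-- The condition tested by the second loop for the neighbour `u` of `v`. -/
def ThinAt (adj : Fin n → List (Fin n)) (v u : Fin n) : Prop :=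
  ∃ a b, OtherEntry adj v u a ∧ OtherEntry adj u a b ∧ ∃ w ∈ adj v, OtherEntry adj v w b

/-- Loop invariant: j entries of the list of v have been examined without success and k remain. The
answer is a free variable constrained by two implications. -/
theorem ends_second_loop (h : IsAdjacencyLists G adj) {ans : Bool}
    (htrue : (∃ u ∈ adj v, ThinAt adj v u) → ans = true)
    (hfalse : (¬ ∃ u ∈ adj v, ThinAt adj v u) → ans = false)
    (hone : ∀ u ∈ adj v, (adj u).length ≠ 1) (k : ℕ) :
    ∀ (j : ℕ) (r m : ℕ → ℕ), j + k = (adj v).length → HoldsInput adj v m →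
      HoldsMarks adj v (adj v) m → HoldsConstants adj v r → r 5 = listAddress adj v + j →
      r 6 = k → (∀ u ∈ (adj v).take j, ¬ ThinAt adj v u) →
      Ends sheddingProgram ⟨24, r, m⟩ (30 * k + 2) ans := by
  induction k with
  | zero =>
    intro j r m hj hm hM hr h5 h6 hno
    refine .jumpLt_of_le rfl (by rw [h6, hr.r10]) (.halt ?_)
    rw [hfalse]
    · rfl
    · rintro ⟨u, hu, hT⟩
      rw [show j = (adj v).length by omega, List.take_length] at hno
      exact hno u hu hT
  | succ k ih =>
    intro j r m hj hm hM hr h5 h6 hno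
    obtain ⟨r0, r1, r2, r3, r4, r10⟩ := hr
    have hjl : j < (adj v).length := by omega
    set u := (adj v)[j]
    have humem : u ∈ adj v := List.getElem_mem hjl
    have huv : G.Adj u v := (((h v).2 u).mp humem).symm
    have hent : m (listAddress adj v + (j + 1)) = u := hm.entry v j hjl
    have hpos : (adj u).length ≠ 0 := fun e => by
      have := ((h u).2 v).mpr huv
      rw [List.length_eq_zero_iff.mp e] at this
      simp at this
    have hnext : ¬ ThinAt adj v u → ∀ w ∈ (adj v).take (j + 1), ¬ ThinAt adj v w := by
      intro hT w hw
      rw [List.take_succ_eq_append_getElem hjl, List.mem_append, List.mem_singleton] at hw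
      rcases hw with hw | rfl
      · exact hno w hw
      · exact hT
    -- A pass through the body takes at most 22 steps.
    refine Ends.mono (T := 30 * k + 2 + 24) ?_ (by omega)
    refine .jumpLt_of_lt rfl (by rw [h6, r10]; omega) ?_
    refine .dec rfl (x := k) (by rw [h6]; rfl) ?_
    refine .inc rfl (x := listAddress adj v + (j + 1)) (by simp [h5, add_assoc]) ?_
    refine .load rfl (x := u) (by simp [r10, hent]) ?_
    refine .load rfl (x := listAddress adj u) (by simp [r3, hm.address]) ?_
    refine .load rfl (x := (adj u).length) (by simp [r10, hm.length]) ?_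
    rcases Nat.lt_or_ge 2 (adj u).length with hl | hl
    · refine .jumpLt_of_lt rfl (by simp [r3, hl]) ?_
      refine (ih (j + 1) _ m (by omega) hm hM ?_ (by simp) (by simp) (hnext ?_)).mono (by omega)
      · constructor <;> simp [*]
      · rintro ⟨a, b, ha, -⟩
        exact absurd ha.1 (by omega)
    have hl2 : (adj u).length = 2 := by
      have := hone u humem
      omega
    refine .jumpLt_of_le rfl (by simp [r3, hl]) ?_
    obtain ⟨a, ha, hma⟩ := exists_otherEntry h huv hl2 hm
    refine .select rfl rfl rfl rfl (a := a) (by decide) (by decide) (by decide)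
      (by simpa [r1, r2, r3] using hma) ?_
    have hau : G.Adj a u := ((otherEntry_iff h huv).mp ha).adj.symm
    refine .load rfl (x := listAddress adj a) (by simp [r3, hm.address]) ?_
    refine .load rfl (x := (adj a).length) (by simp [r10, hm.length]) ?_
    have hT : ThinAt adj v u ↔ ∃ b, OtherEntry adj u a b ∧ ∃ w ∈ adj v, OtherEntry adj v w b := by
      constructor
      · rintro ⟨a', b, ha', hb⟩
        obtain rfl := ha.unique h huv ha'
        exact ⟨b, hb⟩
      · rintro ⟨b, hb⟩
        exact ⟨a, b, ha, hb⟩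
    rcases Nat.lt_or_ge 2 (adj a).length with hla | hla
    · refine .jumpLt_of_lt rfl (by simp [r3, hla]) ?_
      refine (ih (j + 1) _ m (by omega) hm hM ?_ (by simp) (by simp) (hnext ?_)).mono (by omega)
      · constructor <;> simp [*]
      · rw [hT]
        rintro ⟨b, hb, -⟩
        exact absurd hb.1 (by omega)
    refine .jumpLt_of_le rfl (by simp [r3, hla]) ?_
    rcases Nat.lt_or_ge 1 (adj a).length with hla' | hla'
    swap
    · refine .jumpLt_of_le rfl (by simp [r2, hla']) ?_
      refine .jump rfl ?_
      refine (ih (j + 1) _ m (by omega) hm hM ?_ (by simp) (by simp) (hnext ?_)).mono (by omega)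
      · constructor <;> simp [*]
      · rw [hT]
        rintro ⟨b, hb, -⟩
        exact absurd hb.1 (by omega)
    refine .jumpLt_of_lt rfl (by simp [r2, hla']) ?_
    obtain ⟨b, hb, hmb⟩ := exists_otherEntry h hau (by omega) hm
    refine .select rfl rfl rfl rfl (a := b) (by decide) (by decide) (by decide)
      (by simpa [r2, r3] using hmb) ?_
    refine .load rfl (x := m ((encodeInput adj v).length + b)) (by simp [r0]) ?_
    rcases Nat.eq_zero_or_pos (m ((encodeInput adj v).length + b)) with hz | hz
    · refine .jumpLt_of_le rfl (by simp [hz]) ?_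
      refine .jump rfl ?_
      refine (ih (j + 1) _ m (by omega) hm hM ?_ (by simp) (by simp) (hnext ?_)).mono (by omega)
      · constructor <;> simp [*]
      · rw [hT]
        rintro ⟨b', hb', hw⟩
        obtain rfl := hb.unique h hau hb'
        have := (hM b).mpr hw
        omega
    · refine .jumpLt_of_lt rfl (by simpa [r10] using hz) (.halt ?_)
      rw [htrue ⟨u, humem, hT.mpr ⟨b, hb, (hM b).mp hz⟩⟩]
      rfl

/-- The marks invariant covers the j entries already read. The bound includes the cost of the second
loop, which starts when k reaches 0. -/
theorem ends_first_loop (h : IsAdjacencyLists G adj) {ans : Bool}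
    (hpend : (∃ u ∈ adj v, (adj u).length = 1) → ans = true)
    (htrue : (∃ u ∈ adj v, ThinAt adj v u) → ans = true)
    (hfalse : (¬ ∃ u ∈ adj v, (adj u).length = 1) → (¬ ∃ u ∈ adj v, ThinAt adj v u) → ans = false)
    (k : ℕ) :
    ∀ (j : ℕ) (r m : ℕ → ℕ), j + k = (adj v).length → HoldsInput adj v m →
      HoldsMarks adj v ((adj v).take j) m → HoldsConstants adj v r →
      r 5 = listAddress adj v + j → r 6 = k → (∀ u ∈ (adj v).take j, (adj u).length ≠ 1) →
      Ends sheddingProgram ⟨6, r, m⟩ (20 * k + 30 * (adj v).length + 10) ans := by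
  induction k with
  | zero =>
    intro j r m hj hm hM hr h5 h6 hno
    rw [show j = (adj v).length by omega, List.take_length] at hno hM
    have hr' := hr
    obtain ⟨r0, r1, r2, r3, r4, r10⟩ := hr
    refine .jumpLt_of_le rfl (by rw [h6, r10]) ?_
    refine .jump rfl ?_
    refine .load rfl (x := (adj v).length) (by simp [r4, r10, hm.length]) ?_
    refine .copy rfl (x := listAddress adj v) (by simp [r4]) ?_
    refine (ends_second_loop h htrue (hfalse ?_) hno (adj v).length 0 _ m (by omega) hm hM ?_
      (by simp) (by simp) (by simp)).mono (by omega)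
    · rintro ⟨u, hu, hl⟩
      exact hno u hu hl
    · constructor <;> simp [*]
  | succ k ih =>
    intro j r m hj hm hM hr h5 h6 hno
    obtain ⟨r0, r1, r2, r3, r4, r10⟩ := hr
    have hjl : j < (adj v).length := by omega
    set u := (adj v)[j]
    have humem : u ∈ adj v := List.getElem_mem hjl
    have huv : G.Adj u v := (((h v).2 u).mp humem).symm
    have hent : m (listAddress adj v + (j + 1)) = u := hm.entry v j hjl
    have hpos : (adj u).length ≠ 0 := fun e => by
      have := ((h u).2 v).mpr huv
      rw [List.length_eq_zero_iff.mp e] at this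
      simp at this
    have hmem : ∀ w, w ∈ (adj v).take (j + 1) ↔ w ∈ (adj v).take j ∨ w = u := by
      intro w
      rw [List.take_succ_eq_append_getElem hjl, List.mem_append, List.mem_singleton]
    refine Ends.mono (T := 20 * k + 30 * (adj v).length + 10 + 14) ?_ (by omega)
    refine .jumpLt_of_lt rfl (by rw [h6, r10]; omega) ?_
    refine .dec rfl (x := k) (by rw [h6]; rfl) ?_
    refine .inc rfl (x := listAddress adj v + (j + 1)) (by simp [h5, add_assoc]) ?_
    refine .load rfl (x := u) (by simp [r10, hent]) ?_
    refine .load rfl (x := listAddress adj u) (by simp [r3, hm.address]) ?_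
    refine .load rfl (x := (adj u).length) (by simp [r10, hm.length]) ?_
    rcases Nat.lt_or_ge 2 (adj u).length with hl | hl
    · refine .jumpLt_of_lt rfl (by simp [r3, hl]) ?_
      refine (ih (j + 1) _ m (by omega) hm ?_ ?_ (by simp) (by simp) ?_).mono (by omega)
      · intro x
        rw [hM x]
        refine exists_congr fun w => ?_
        rw [hmem]
        constructor
        · exact fun hw => ⟨Or.inl hw.1, hw.2⟩
        · rintro ⟨hw | rfl, hx⟩
          · exact ⟨hw, hx⟩
          · exact absurd hx.1 (by omega)
      · constructor <;> simp [*]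
      · intro w hw
        rcases (hmem w).mp hw with hw | rfl
        · exact hno w hw
        · omega
    refine .jumpLt_of_le rfl (by simp [r3, hl]) ?_
    rcases Nat.lt_or_ge 1 (adj u).length with hl' | hl'
    swap
    · refine .jumpLt_of_le rfl (by simp [r2, hl']) (.halt ?_)
      rw [hpend ⟨u, humem, by omega⟩]
      rfl
    refine .jumpLt_of_lt rfl (by simp [r2, hl']) ?_
    obtain ⟨a, ha, hma⟩ := exists_otherEntry h huv (by omega) hm
    refine .select rfl rfl rfl rfl (a := a) (by decide) (by decide) (by decide)
      (by simpa [r1, r2, r3] using hma) ?_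
    refine .store rfl (a := (encodeInput adj v).length + a) (x := 1) (by simp [r0])
      (by simp [r2]) ?_
    refine .jump rfl ?_
    refine (ih (j + 1) _ _ (by omega) (hm.update _ _) ?_ ?_ (by simp) (by simp) ?_).mono (by omega)
    · intro x
      by_cases hx : x = a
      · subst hx
        simp only [Function.update_self, zero_lt_one, true_iff]
        exact ⟨u, (hmem u).mpr (Or.inr rfl), ha⟩
      · rw [Function.update_of_ne (fun e => hx (Fin.ext (by omega))), hM x]
        refine exists_congr fun w => ?_
        rw [hmem]
        constructor
        · exact fun hw => ⟨Or.inl hw.1, hw.2⟩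
        · rintro ⟨hw | rfl, hx'⟩
          · exact ⟨hw, hx'⟩
          · exact absurd (hx'.unique h huv ha) hx
    · constructor <;> simp [*]
    · intro w hw
      rcases (hmem w).mp hw with hw | rfl
      · exact hno w hw
      · omega

theorem hasPendant_iff_length (h : IsAdjacencyLists G adj) :
    HasPendant G v ↔ ∃ u ∈ adj v, (adj u).length = 1 := by
  rw [← isStem_iff_hasPendant]
  refine exists_congr fun u => and_congr ((h v).2 u).symm ?_
  have : G.neighborSet u = ((adj u).toFinset : Set (Fin n)) := by
    ext w
    simp [(h u).2]
  rw [IsLeaf, deg, this, Set.ncard_coe_finset, List.toFinset_card_of_nodup (h u).1]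

theorem hasThinCycle_iff_thinAt (h : IsAdjacencyLists G adj) :
    HasThinCycle G v ↔ ∃ u ∈ adj v, ThinAt adj v u := by
  constructor
  · rintro ⟨u₁, u₂, a, b, hne, h₁, h₂, ha, hb, hab⟩
    exact ⟨u₁, ((h v).2 u₁).mpr h₁, a, b, (otherEntry_iff h h₁.symm).mpr ha,
      (otherEntry_iff h ha.adj.symm).mpr hab, u₂, ((h v).2 u₂).mpr h₂,
      (otherEntry_iff h h₂.symm).mpr hb⟩
  · rintro ⟨u₁, h₁, a, b, ha, hab, u₂, h₂, hb⟩
    have h₁ := ((h v).2 u₁).mp h₁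
    have h₂ := ((h v).2 u₂).mp h₂
    have ha := (otherEntry_iff h h₁.symm).mp ha
    have hab := (otherEntry_iff h ha.adj.symm).mp hab
    have hb := (otherEntry_iff h h₂.symm).mp hb
    refine ⟨u₁, u₂, a, b, ?_, h₁, h₂, ha, hb, hab⟩
    -- The program need not check that the mark on b comes from another neighbour of v: if u₁ = u₂
    -- then b = a, although a and b are adjacent.
    rintro rfl
    exact hab.adj.ne ((hb.only a ha.adj).resolve_left ha.ne)

theorem sheddingProgram_answersWithin (h : IsAdjacencyLists G adj) :
    ∃ ans : Bool, AnswersWithin sheddingProgram (encodeInput adj v) (70 * n) ans ∧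
      (ans = true ↔ HasPendant G v ∨ HasThinCycle G v) := by
  classical
  refine ⟨decide (HasPendant G v ∨ HasThinCycle G v), ?_, decide_eq_true_iff⟩
  have hn : (adj v).length ≤ n := by simpa using (h v).1.length_le_card
  have hnpos : 0 < n := v.pos
  have hm : HoldsInput adj v fun k => (encodeInput adj v).getD k 0 := fun k _ => rfl
  have hP := hasPendant_iff_length (v := v) h
  have hT := hasThinCycle_iff_thinAt (v := v) h
  -- The final 6 counts the initialising instructions; 50 d(v) + 16 ≤ 70 n because d(v) ≤ n and n ≥
  -- 1.
  suffices H : Ends sheddingProgram (init (encodeInput adj v)) (20 * (adj v).length +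
      30 * (adj v).length + 10 + 6) (decide (HasPendant G v ∨ HasThinCycle G v)) from
    H.mono (by omega)
  refine .const rfl (.const rfl ?_)
  refine .load rfl (x := v) (by simpa using hm.vertex) ?_
  refine .load rfl (x := listAddress adj v) (by simpa using hm.address v) ?_
  refine .load rfl (x := (adj v).length) (by simpa using hm.length v) ?_
  refine .copy rfl (x := listAddress adj v) (by simp) ?_
  refine ends_first_loop h (fun hp => ?_) (fun ht => ?_) (fun hp ht => ?_) (adj v).length 0 _ _
    (by omega) hm ?_ ?_ (by simp) (by simp) (by simp)
  · simp [hP.mpr hp]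
  · simp [hT.mpr ht]
  · simp [hP, hT, hp, ht]
  -- Cells behind the input are initially 0, so no vertex is marked and no clearing is needed.
  · intro x
    simp
  · constructor <;> simp

end Program

theorem mainTheorem12 :
    ∃ (P : RAM.Program) (c : ℕ), ∀ (n : ℕ) (G : SimpleGraph (Fin n)) (v : Fin n),
      G.Connected → WellCovered G → 5 ≤ G.egirth →
        -- the program `P` decides in at most `c * n` steps whether `v` is shedding
        (∀ adj : Fin n → List (Fin n), IsAdjacencyLists G adj →
          ∃ b : Bool, RAM.AnswersWithin P (encodeInput adj v) (c * n) b ∧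
            (b = true ↔ Shedding G v)) ∧
        -- the case analysis
        (IsLeaf G v → (Shedding G v ↔ n = 2)) ∧
        (IsStem G v → Shedding G v) ∧
        (∀ C : Set (Fin n), IsBasicFiveCycle G C → v ∈ C → deg G v = 2 →
          (Shedding G v ↔ ∀ u, G.Adj v u → G.neighborSet u ⊆ C)) ∧
        (∀ C : Set (Fin n), IsBasicFiveCycle G C → v ∈ C → 3 ≤ deg G v → Shedding G v) ∧
        (¬ IsLeaf G v → ¬ IsStem G v → (¬ ∃ C : Set (Fin n), IsBasicFiveCycle G C ∧ v ∈ C) →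
          ¬ Shedding G v) := by
  refine ⟨sheddingProgram, 70, fun n G v hconn hwc hgirth => ?_⟩
  have h := girthFive_of_egirth hgirth
  have hT := hwc.noTwinLeaves h
  refine ⟨fun adj hadj => ?_, shedding_leaf_iff h hT hconn,
    fun hs => (isStem_iff_hasPendant.mp hs).shedding,
    fun C hC hv hd => shedding_iff_of_deg_eq_two h hT hC hv hd,
    fun C hC hv hd => shedding_of_three_le_deg hC hv hd, fun _ hs hC hsh => ?_⟩
  · obtain ⟨ans, hans, hiff⟩ := sheddingProgram_answersWithin (v := v) hadj
    exact ⟨ans, hans, hiff.trans (shedding_iff h hT).symm⟩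
  · rcases hsh.hasPendant_or_hasThinCycle h hT with hp | hc
    · exact hs (isStem_iff_hasPendant.mpr hp)
    · exact hC (hc.exists_isBasicFiveCycle h)
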